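/- Let $d\ge 1$, let $\Omega\subset\mathbb{R}^d$ be an open bounded polytope (with $\Omega$ equal to the interior of its closure) and let $\mathcal{T}_H$ be a conforming simplicial mesh of $\Omega$. Let $m>0$ and $b\in\mathbb{R}^d$ be constant, write $\mathcal{L}u=-m\Delta u+b\cdot\nabla u$, and let $f$ be piecewise constant, equal to $f_K$ on each $K\in\mathcal{T}_H$. Set $$a(u,v)=\int_\Omega m\,\nabla u\cdot\nabla v+v\,b\cdot\nabla u,\qquad F(v)=\int_\Omega f\,v .$$ Let $V_H$ be the space of continuous functions on $\overline\Omega$ that are affine on each $K\in\mathcal{T}_H$ and vanish on $\partial\Omega$, with nodal basis $\phi_1,\dots,\phi_N$ ($\phi_i(x_j)=\delta_{ij}$ for the mesh vertices $x_j\notin\partial\Omega$). For each $K\in\mathcal{T}_H$ let $B_K\in H^1_0(K)$ be the solution to $\mathcal{L}B_K=1$ in $K$, and for $1\le\alpha\le d$ let $\chi_K^\alpha\in H^1_0(K)$ be the solution to $\mathcal{L}\chi_K^\alpha=-\mathcal{L}x^\alpha$ in $K$ (both extended by $0$ outside $K$). Let $\phi_i^{\rm adv}\in H^1_0(\Omega)$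 be the function such that, for each $K$, $\mathcal{L}\phi_i^{\rm adv}=0$ in $K$ and $\phi_i^{\rm adv}=\phi_i$ on $\partial K$. Set $V_H^{\rm adv}=\mathrm{Span}\{\phi_i^{\rm adv}\}_i$ and $V_{H,B}^{\rm adv}=V_H^{\rm adv}+\mathrm{Span}\{B_K\}_K$. The Adv-MsFEM-lin (resp. Adv-MsFEM-lin-B) method consists in finding $u\in W$ such that $a(u,v)=F(v)$ for all $v\in W$, with $W=V_H^{\rm adv}$ (resp. $W=V_{H,B}^{\rm adv}$). Define the piecewise constant parameter $\tau^B|_K=\frac1{|K|}\int_K B_K$ and, for $u_H,v_H\in V_H$, $$a_{\rm stab}(u_H,v_H)=\sum_{K\in\mathcal{T}_H}\int_K\tau^B\,(b\cdot\nabla u_H)(b\cdot\nabla v_H),\qquad F_{\rm stab}(v_H)=\sum_{K\in\mathcal{T}_H}\int_K\tau^B f\,(b\cdot\nabla v_H).$$ All the above objects ($B_K$, $\chi_K^\alpha$, $\phi_i$, $\phi_i^{\rm adv}$) exist and are unique, and the following holds. (i) Adv-MsFEM-lin-B has a unique solution. Each $u\in V_{H,B}^{\rm adv}$ can be written in a unique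 way as $$u=u_H+\sum_{K\in\mathcal{T}_H}\sum_{\alpha=1}^d\partial_\alpha(u_H|_K)\,\chi_K^\alpha+\sum_{K\in\mathcal{T}_H}\beta_K B_K,\qquad u_H\in V_H,\ \beta_K\in\mathbb{R}.$$ For all $u_H\in V_H$ and $(\beta_K)_K$, the function given by this formula is the Adv-MsFEM-lin-B solution if and only if $\beta_K=f_K$ for each $K\in\mathcal{T}_H$ and $u_H$ solves the $\mathbb{P}_1$ SUPG scheme with parameter $\tau^B$, $$\forall v_H\in V_H,\quad a(u_H,v_H)+a_{\rm stab}(u_H,v_H)=F(v_H)+F_{\rm stab}(v_H),$$ and this scheme has a unique solution $u_H\in V_H$. (ii) Adv-MsFEM-lin has a unique solution. Each $u\in V_H^{\rm adv}$ can be written in a unique way as $u=u_H+\sum_{K}\sum_{\alpha}\partial_\alpha(u_H|_K)\,\chi_K^\alpha$ with $u_H\in V_H$. For all $u_H\in V_H$, the function given by this formula is the Adv-MsFEM-lin solution if and only if $$\forall v_H\in V_H,\quad a(u_H,v_H)+a_{\rm stab}(u_H,v_H)=F(v_H)-F_{\rm stab}(v_H),$$ and this scheme has a unique solution $u_H\in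 V_H$. -/

import Mathlib

open MeasureTheory Set Filter Topology
open scoped RealInnerProductSpace ContDiff

noncomputable section

namespace AdvMsFEM

/-- `ℝ^d` with its Euclidean norm. -/
abbrev Sp (d : ℕ) : Type := EuclideanSpace ℝ (Fin d)

/-- The Hilbert space `L²(ℝ^d) × L²(ℝ^d)^d` with norm `(‖u‖² + ‖g‖²)^{1/2}`. A function of class
`H¹` is handled as the pair `(u, ∇u)`, so that on such pairs this norm is the `H¹` norm. -/
abbrev L2Grad (d : ℕ) : Type :=
  WithLp 2 (Lp ℝ 2 (volume : Measure (Sp d)) × Lp (Sp d) 2 (volume : Measure (Sp d)))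

/-- The pairs `(φ, ∇φ)` with `φ ∈ C_c^∞(U)` (extended by zero outside `U`). -/
def testGraph {d : ℕ} (U : Set (Sp d)) : Set (L2Grad d) :=
  {w | ∃ φ : Sp d → ℝ, ContDiff ℝ ∞ φ ∧ HasCompactSupport φ ∧ tsupport φ ⊆ U ∧
    w.fst =ᵐ[volume] φ ∧ w.snd =ᵐ[volume] gradient φ}

/-- `H¹₀(U)` for an open set `U`: the closure of `C_c^∞(U)` in the `H¹` norm. An element is the pair
`(u, ∇u)`, extended by zero outside `U`; in particular `H¹₀(K) ⊆ H¹₀(Ω)` if `K ⊆ Ω`. -/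
def H10 {d : ℕ} (U : Set (Sp d)) : Submodule ℝ (L2Grad d) :=
  (Submodule.span ℝ (testGraph U)).topologicalClosure

/-- `∫_U m ∇u · ∇v + v b · ∇u`, in terms of `∇u`, `v` and `∇v`. -/
def advForm {d : ℕ} (m : ℝ) (b : Sp d) (U : Set (Sp d))
    (gu : Sp d → Sp d) (v : Sp d → ℝ) (gv : Sp d → Sp d) : ℝ :=
  ∫ x in U, (m * ⟪gu x, gv x⟫ + v x * ⟪b, gu x⟫)

/-- The bilinear form `a_U(u, v) = ∫_U m ∇u · ∇v + v b · ∇u` on `H¹` functions. -/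
def aForm {d : ℕ} (m : ℝ) (b : Sp d) (U : Set (Sp d)) (u v : L2Grad d) : ℝ :=
  advForm m b U u.snd v.fst v.snd

/-- `u = v` on `∂U`: the restriction to `U` of `u - v` is in `H¹₀(U)`. -/
def EqOnBoundary {d : ℕ} (U : Set (Sp d)) (u v : L2Grad d) : Prop :=
  ∃ z ∈ H10 U,
    (∀ᵐ x ∂(volume.restrict U), z.fst x = u.fst x - v.fst x) ∧
    (∀ᵐ x ∂(volume.restrict U), z.snd x = u.snd x - v.snd x)

/-- A conforming simplicial mesh of the domain `Ω`: finitely many simplices, any two of which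
meet along a common face (this is part of `Geometry.SimplicialComplex`), each one being a face of a
simplex of dimension `d`, and which together cover exactly the closure of `Ω`. -/
structure Mesh {d : ℕ} (Ω : Set (Sp d)) where
  complex : Geometry.SimplicialComplex ℝ (Sp d)
  finite_faces : complex.faces.Finite
  pure_dim : ∀ s ∈ complex.faces, ∃ t ∈ complex.faces, s ⊆ t ∧ t.card = d + 1
  space_eq : complex.space = closure Ω

/-- The open simplex spanned by a set of vertices. -/
def openSimplex {d : ℕ} (K : Finset (Sp d)) : Set (Sp d) :=
  interior (convexHull ℝ (K : Set (Sp d)))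

theorem measurableSet_openSimplex {d : ℕ} (K : Finset (Sp d)) : MeasurableSet (openSimplex K) :=
  isOpen_interior.measurableSet

theorem volume_openSimplex_ne_top {d : ℕ} (K : Finset (Sp d)) :
    (volume : Measure (Sp d)) (openSimplex K) ≠ ⊤ :=
  ((measure_mono interior_subset).trans_lt
    (K.finite_toSet.isCompact_convexHull ℝ).measure_lt_top).ne

namespace Mesh

variable {d : ℕ} {Ω : Set (Sp d)}

/-- The mesh elements (given by their vertices). -/
def cells (T : Mesh Ω) : Finset (Finset (Sp d)) :=
  T.finite_faces.toFinset.filter fun s => s.card = d + 1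

theorem isCompact_closure (T : Mesh Ω) : IsCompact (closure Ω) := by
  rw [← T.space_eq, Geometry.SimplicialComplex.space]
  exact T.finite_faces.isCompact_biUnion fun s _ => s.finite_toSet.isCompact_convexHull ℝ

/-- The space `V_H`: the continuous functions on the closure of `Ω` that are affine on each mesh
element and vanish on `∂Ω`, extended by zero to `ℝ^d`. -/
def VH (T : Mesh Ω) : Submodule ℝ (Sp d → ℝ) where
  carrier := {v | Continuous v ∧ (∀ x, x ∉ Ω → v x = 0) ∧
    ∀ K ∈ T.cells, ∃ (a : Sp d) (c : ℝ), ∀ x ∈ convexHull ℝ (K : Set (Sp d)), v x = ⟪a, x⟫ + c}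
  zero_mem' := ⟨continuous_const, fun _ _ => rfl, fun _ _ => ⟨0, 0, fun x _ => by simp⟩⟩
  add_mem' := by
    rintro u v ⟨hu, hu0, huK⟩ ⟨hv, hv0, hvK⟩
    refine ⟨hu.add hv, fun x hx => by simp [hu0 x hx, hv0 x hx], fun K hK => ?_⟩
    obtain ⟨a, c, h⟩ := huK K hK
    obtain ⟨a', c', h'⟩ := hvK K hK
    refine ⟨a + a', c + c', fun x hx => ?_⟩
    rw [Pi.add_apply, h x hx, h' x hx, inner_add_left]
    ring
  smul_mem' := by
    rintro r v ⟨hv, hv0, hvK⟩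
    refine ⟨hv.const_smul r, fun x hx => by simp [hv0 x hx], fun K hK => ?_⟩
    obtain ⟨a, c, h⟩ := hvK K hK
    refine ⟨r • a, r * c, fun x hx => ?_⟩
    rw [Pi.smul_apply, h x hx, real_inner_smul_left, smul_eq_mul]
    ring

theorem memLp_of_mem_VH (T : Mesh Ω) (v : T.VH) :
    MemLp (v : Sp d → ℝ) 2 (volume : Measure (Sp d)) := by
  refine v.2.1.memLp_of_hasCompactSupport (HasCompactSupport.of_support_subset_isCompact
    T.isCompact_closure fun x hx => subset_closure ?_)
  by_contra h
  exact hx (v.2.2.1 x h)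

/-- The constant gradient `∇(v|_K)` of `v ∈ V_H` on the element `K`, read off at the centroid of
`K`, an interior point. -/
def cellGrad (v : Sp d → ℝ) (K : Finset (Sp d)) : Sp d :=
  gradient v (K.centroid ℝ id)

/-- The element `(v, ∇v)` given by `v ∈ V_H`; here `∇v` is the piecewise constant gradient. -/
def toL2Grad (T : Mesh Ω) (v : T.VH) : L2Grad d :=
  WithLp.toLp 2 ((T.memLp_of_mem_VH v).toLp (v : Sp d → ℝ),
    ∑ K ∈ T.cells, indicatorConstLp 2 (measurableSet_openSimplex K)
      (volume_openSimplex_ne_top K) (cellGrad v K))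

/-- `φ` is an element of the standard (nodal) basis of `V_H`: it equals `1` at one mesh vertex that
is not on `∂Ω` and `0` at all the other ones. -/
def IsNodal (T : Mesh Ω) (φ : T.VH) : Prop :=
  ∃ x ∈ T.complex.vertices ∩ Ω, (φ : Sp d → ℝ) x = 1 ∧
    ∀ y ∈ T.complex.vertices ∩ Ω, y ≠ x → (φ : Sp d → ℝ) y = 0

end Mesh

/-- `B` is the bubble function of the element `K`: `-m Δ B + b · ∇B = 1` in `K` and
`B = 0` on `∂K`. -/
def IsBubble {d : ℕ} (m : ℝ) (b : Sp d) (K : Finset (Sp d)) (B : L2Grad d) : Prop :=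
  B ∈ H10 (openSimplex K) ∧ ∀ v ∈ H10 (openSimplex K),
    aForm m b (openSimplex K) B v = ∫ x in openSimplex K, v.fst x

/-- `χ` is the numerical corrector of index `α` of the element `K`: with
`L u = -m Δ u + b · ∇u`, it satisfies `L χ = - L x^α` in `K` and `χ = 0` on `∂K`. -/
def IsCorrector {d : ℕ} (m : ℝ) (b : Sp d) (K : Finset (Sp d)) (α : Fin d) (χ : L2Grad d) : Prop :=
  χ ∈ H10 (openSimplex K) ∧ ∀ v ∈ H10 (openSimplex K),
    aForm m b (openSimplex K) χ v =
      -advForm m b (openSimplex K) (gradient fun x : Sp d => x α) v.fst v.snd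

namespace Mesh

variable {d : ℕ} {Ω : Set (Sp d)}

/-- `w` is the multiscale function with boundary data `φ ∈ V_H`: `w ∈ H¹₀(Ω)`, and in each element
`K`, `-m Δ w + b · ∇w = 0` in `K` and `w = φ` on `∂K`. -/
def IsMultiscale (T : Mesh Ω) (m : ℝ) (b : Sp d) (φ : T.VH) (w : L2Grad d) : Prop :=
  w ∈ H10 Ω ∧ ∀ K ∈ T.cells,
    (∀ v ∈ H10 (openSimplex K), aForm m b (openSimplex K) w v = 0) ∧
    EqOnBoundary (openSimplex K) w (T.toL2Grad φ)

/-- The multiscale space `V_H^adv`, spanned by the multiscale basis functions. -/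
def VHadv (T : Mesh Ω) (m : ℝ) (b : Sp d) : Submodule ℝ (L2Grad d) :=
  Submodule.span ℝ {w | ∃ φ : T.VH, T.IsNodal φ ∧ T.IsMultiscale m b φ w}

/-- The space `V_{H,B}^adv`: multiscale basis functions and bubbles. -/
def VHBadv (T : Mesh Ω) (m : ℝ) (b : Sp d) : Submodule ℝ (L2Grad d) :=
  T.VHadv m b ⊔ Submodule.span ℝ {B | ∃ K ∈ T.cells, IsBubble m b K B}

/-- `u` is a Galerkin solution on the space `W`: `u ∈ W` and `a(u, v) = ∫_Ω f v` for all
`v ∈ W`. -/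
def IsGalerkin (_T : Mesh Ω) (m : ℝ) (b : Sp d) (f : Sp d → ℝ)
    (W : Submodule ℝ (L2Grad d)) (u : L2Grad d) : Prop :=
  u ∈ W ∧ ∀ v ∈ W, aForm m b Ω u v = ∫ x in Ω, f x * v.fst x

/-- `u` is a solution of Adv-MsFEM-lin. -/
def IsAdvMsFEMLin (T : Mesh Ω) (m : ℝ) (b : Sp d) (f : Sp d → ℝ) (u : L2Grad d) : Prop :=
  T.IsGalerkin m b f (T.VHadv m b) u

/-- `u` is a solution of Adv-MsFEM-lin-B. -/
def IsAdvMsFEMLinB (T : Mesh Ω) (m : ℝ) (b : Sp d) (f : Sp d → ℝ) (u : L2Grad d) : Prop :=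
  T.IsGalerkin m b f (T.VHBadv m b) u

/-- `v + Σ_K Σ_α ∂_α(v|_K) χ_K^α` for `v ∈ V_H`. -/
def withCorrectors (T : Mesh Ω) (χ : T.cells → Fin d → L2Grad d) (v : T.VH) : L2Grad d :=
  T.toL2Grad v + ∑ K : T.cells, ∑ α : Fin d, (cellGrad v (K : Finset (Sp d))) α • χ K α

/-- The stabilization parameter `τ^B|_K = |K|⁻¹ ∫_K B_K`. -/
def tauB (T : Mesh Ω) (B : T.cells → L2Grad d) (K : T.cells) : ℝ :=
  (volume.real (openSimplex (K : Finset (Sp d))))⁻¹ *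
    ∫ x in openSimplex (K : Finset (Sp d)), (B K).fst x

/-- `a_stab(u, v) = Σ_K ∫_K τ (b · ∇u) (b · ∇v)`. -/
def aStab (T : Mesh Ω) (b : Sp d) (τ : T.cells → ℝ) (u v : T.VH) : ℝ :=
  ∑ K : T.cells, ∫ x in openSimplex (K : Finset (Sp d)),
    τ K * ⟪b, gradient (u : Sp d → ℝ) x⟫ * ⟪b, gradient (v : Sp d → ℝ) x⟫

/-- `F_stab(v) = Σ_K ∫_K τ f (b · ∇v)`. -/
def FStab (T : Mesh Ω) (b : Sp d) (f : Sp d → ℝ) (τ : T.cells → ℝ) (v : T.VH) : ℝ :=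
  ∑ K : T.cells, ∫ x in openSimplex (K : Finset (Sp d)),
    τ K * f x * ⟪b, gradient (v : Sp d → ℝ) x⟫

/-- `u ∈ V_H` solves the `P₁` SUPG scheme with stabilization parameter `τ`:
`a(u, v) + a_stab(u, v) = F(v) + F_stab(v)` for all `v ∈ V_H`. -/
def IsSUPG (T : Mesh Ω) (m : ℝ) (b : Sp d) (f : Sp d → ℝ) (τ : T.cells → ℝ) (u : T.VH) : Prop :=
  ∀ v : T.VH,
    advForm m b Ω (gradient (u : Sp d → ℝ)) v (gradient (v : Sp d → ℝ)) + T.aStab b τ u v =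
      (∫ x in Ω, f x * (v : Sp d → ℝ) x) + T.FStab b f τ v

/-- The scheme with the left-hand side of `P₁` SUPG and the opposite sign in front of the
stabilization term of the right-hand side: `a(u, v) + a_stab(u, v) = F(v) - F_stab(v)`. -/
def IsSUPGOpposite (T : Mesh Ω) (m : ℝ) (b : Sp d) (f : Sp d → ℝ) (τ : T.cells → ℝ)
    (u : T.VH) : Prop :=
  ∀ v : T.VH,
    advForm m b Ω (gradient (u : Sp d → ℝ)) v (gradient (v : Sp d → ℝ)) + T.aStab b τ u v =
      (∫ x in Ω, f x * (v : Sp d → ℝ) x) - T.FStab b f τ v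

end Mesh

end AdvMsFEM

end

/-! With constant coefficients, all the local functions on an element `K` are multiples of the
single bubble `B_K`. Since `L x^α = b^α` is constant, uniqueness gives `χ_K^α = -b^α B_K`, and the
multiscale function with boundary data `φ` is `φ - Σ_K (b · ∇φ|_K) B_K`. Hence `V_H^adv` is the
image of `V_H` under a linear map, `lift`, and `V_{H,B}^adv` is `V_H` plus the bubbles.

Two identities, for `v ∈ V_H` and `z ∈ H¹₀(K)`, do the algebra: `a(v, z) = (b · ∇v|_K) ∫_K z` and
`a(z, v) = -(b · ∇v|_K) ∫_K z` (`globalForm_toL2Grad_left`, `globalForm_toL2Grad_right`). The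
diffusion term drops because `∫_K ∇z = 0`, and the sign flips because the advection term is
antisymmetric on `H¹₀(Ω)`, `b` being constant. Consequently `a(lift u, z) = 0`, while `a(lift u, v)
= a(u, v) + a_stab(u, v)`, because `∫_K B_K = |K| τ^B|_K`.

With bubbles, testing against `B_K` gives `β_K ∫_K B_K = f_K ∫_K B_K`, hence `β_K = f_K` as `∫_K B_K
> 0`; testing against `v ∈ V_H`, the bubble part contributes `-F_stab(v)` on the left, that is
`+F_stab(v)` on the right. Without bubbles the test function is `lift v`: the form does not see its
bubble part, but the load does, and this leaves `-F_stab(v)`.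

Well-posedness is Lax–Milgram, from `a(u, u) = m ‖∇u‖²` and the Poincaré inequality; the schemes for
`u_H` inherit it through the equivalences and the injectivity of `lift`. The analytic work is to
show `V_H ⊆ H¹₀(Ω)` (`toL2Grad_mem_H10`), by soft thresholding and mollification, and the geometric
work is to build the nodal functions knowing only that `Ω` is the interior of its closure
(`mem_of_bary_pos_of_mem`). -/

noncomputable section

namespace AdvMsFEM

/-! ### The space `H¹₀(U)`, the advection–diffusion form and integration by parts -/

section

variable {d : ℕ}

theorem continuous_gradient {φ : Sp d → ℝ} (hφ : ContDiff ℝ ∞ φ) : Continuous (gradient φ) :=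
  (InnerProductSpace.toDual ℝ (Sp d)).symm.continuous.comp (hφ.continuous_fderiv (by simp))

theorem tsupport_gradient_subset (φ : Sp d → ℝ) : tsupport (gradient φ) ⊆ tsupport φ := by
  refine (closure_mono ?_).trans (tsupport_fderiv_subset ℝ)
  intro x hx h
  exact hx (by simp [gradient, h])

theorem inner_gradient (φ : Sp d → ℝ) (x c : Sp d) : ⟪c, gradient φ x⟫ = fderiv ℝ φ x c := by
  rw [real_inner_comm, ← InnerProductSpace.toDual_apply_apply (𝕜 := ℝ), toDual_gradient]

theorem hasCompactSupport_gradient {φ : Sp d → ℝ} (hφ : HasCompactSupport φ) :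
    HasCompactSupport (gradient φ) :=
  hφ.of_isClosed_subset (isClosed_tsupport _) (tsupport_gradient_subset φ)

theorem exists_mem_testGraph {U : Set (Sp d)} {φ : Sp d → ℝ} (hφ : ContDiff ℝ ∞ φ)
    (hc : HasCompactSupport φ) (hs : tsupport φ ⊆ U) :
    ∃ w ∈ testGraph U, w.fst =ᵐ[volume] φ ∧ w.snd =ᵐ[volume] gradient φ := by
  have h1 : MemLp φ 2 (volume : Measure (Sp d)) :=
    hφ.continuous.memLp_of_hasCompactSupport hc
  have h2 : MemLp (gradient φ) 2 (volume : Measure (Sp d)) :=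
    (continuous_gradient hφ).memLp_of_hasCompactSupport (hasCompactSupport_gradient hc)
  exact ⟨WithLp.toLp 2 (h1.toLp φ, h2.toLp _), ⟨φ, hφ, hc, hs, h1.coeFn_toLp, h2.coeFn_toLp⟩,
    h1.coeFn_toLp, h2.coeFn_toLp⟩

/-- Test functions are stable under linear combinations, so the span in the definition of `H10` adds
nothing and density arguments need only look at one test function. -/
theorem span_testGraph (U : Set (Sp d)) :
    (Submodule.span ℝ (testGraph U) : Set (L2Grad d)) = testGraph U := by
  let S : Submodule ℝ (L2Grad d) :=
    { carrier := testGraph U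
      zero_mem' := by
        refine ⟨0, contDiff_const, HasCompactSupport.zero, by simp, Lp.coeFn_zero _ _ _, ?_⟩
        filter_upwards [Lp.coeFn_zero (Sp d) 2 (volume : Measure (Sp d))] with x hx
        rw [WithLp.zero_snd, hx]
        simp [gradient]
      add_mem' := by
        rintro u v ⟨φ, h1, h2, h3, h4, h5⟩ ⟨ψ, k1, k2, k3, k4, k5⟩
        refine ⟨φ + ψ, h1.add k1, h2.add k2,
          (tsupport_add φ ψ).trans (union_subset h3 k3), ?_, ?_⟩
        · filter_upwards [Lp.coeFn_add u.fst v.fst, h4, k4] with x hx h k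
          rw [WithLp.add_fst, hx, Pi.add_apply, Pi.add_apply, h, k]
        · filter_upwards [Lp.coeFn_add u.snd v.snd, h5, k5] with x hx h k
          rw [WithLp.add_snd, hx, Pi.add_apply, h, k, gradient, gradient, gradient,
            fderiv_add (h1.differentiable (by simp) x) (k1.differentiable (by simp) x), map_add]
      smul_mem' := by
        rintro r u ⟨φ, h1, h2, h3, h4, h5⟩
        refine ⟨r • φ, h1.const_smul r, h2.smul_left (f := fun _ => r),
          (tsupport_smul_subset_right (fun _ => r) φ).trans h3, ?_, ?_⟩
        · filter_upwards [Lp.coeFn_smul r u.fst, h4] with x hx h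
          rw [WithLp.smul_fst, hx, Pi.smul_apply, Pi.smul_apply, h]
        · filter_upwards [Lp.coeFn_smul r u.snd, h5] with x hx h
          rw [WithLp.smul_snd, hx, Pi.smul_apply, h, gradient, gradient,
            fderiv_const_smul (h1.differentiable (by simp) x), map_smul] }
  exact congrArg _ (Submodule.span_eq S)

/-- A closed property of the pairs `(φ, ∇φ)` with `φ ∈ C_c^∞(U)` holds on `H¹₀(U)`. -/
theorem H10_induction {U : Set (Sp d)} {p : L2Grad d → Prop} (hp : IsClosed {z | p z})
    (h : ∀ z ∈ testGraph U, p z) {z : L2Grad d} (hz : z ∈ H10 U) : p z := by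
  have : (H10 U : Set (L2Grad d)) = closure (testGraph U) := by
    rw [H10, Submodule.topologicalClosure_coe, span_testGraph]
  have hz' : z ∈ closure (testGraph U) := this ▸ hz
  exact closure_minimal h hp hz'

theorem testGraph_subset_H10 (U : Set (Sp d)) : testGraph U ⊆ H10 U :=
  Submodule.subset_span.trans (Submodule.le_topologicalClosure _)

theorem H10_mono {U V : Set (Sp d)} (h : U ⊆ V) : H10 U ≤ H10 V := by
  refine Submodule.topologicalClosure_mono (Submodule.span_mono ?_)
  rintro w ⟨φ, h1, h2, h3, h4⟩
  exact ⟨φ, h1, h2, h3.trans h, h4⟩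

theorem isClosed_H10 (U : Set (Sp d)) : IsClosed (H10 U : Set (L2Grad d)) :=
  Submodule.isClosed_topologicalClosure _

theorem continuous_fst_L2Grad : Continuous fun z : L2Grad d => z.fst :=
  (WithLp.fstL 2 ℝ (Lp ℝ 2 (volume : Measure (Sp d)))
    (Lp (Sp d) 2 (volume : Measure (Sp d)))).continuous

theorem continuous_snd_L2Grad : Continuous fun z : L2Grad d => z.snd :=
  (WithLp.sndL 2 ℝ (Lp ℝ 2 (volume : Measure (Sp d)))
    (Lp (Sp d) 2 (volume : Measure (Sp d)))).continuous

theorem Lp_restrict_eq_zero_iff {E : Type*} [NormedAddCommGroup E] [NormedSpace ℝ E]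
    (s : Set (Sp d)) (f : Lp E 2 (volume : Measure (Sp d))) :
    LpToLpRestrictCLM (Sp d) E ℝ volume 2 s f = 0 ↔ ∀ᵐ x ∂(volume.restrict s), f x = 0 := by
  rw [Lp.ext_iff]
  have h1 := LpToLpRestrictCLM_coeFn ℝ s f
  have h2 := Lp.coeFn_zero E 2 (volume.restrict s : Measure (Sp d))
  constructor
  · intro h
    filter_upwards [h, h1, h2] with x a b c
    rw [← b, a, c, Pi.zero_apply]
  · intro h
    filter_upwards [h, h1, h2] with x a b c
    rw [b, a, c, Pi.zero_apply]

/-- Vanishing outside `U` is the kernel condition of the continuous restriction map to `Uᶜ`, hence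
closed, and test functions satisfy it. -/
theorem fst_ae_eq_zero_of_mem_H10 {U : Set (Sp d)} (hU : MeasurableSet U) {z : L2Grad d}
    (hz : z ∈ H10 U) : ∀ᵐ x, x ∉ U → z.fst x = 0 := by
  have key : LpToLpRestrictCLM (Sp d) ℝ ℝ volume 2 Uᶜ z.fst = 0 := by
    refine H10_induction (p := fun z : L2Grad d =>
      LpToLpRestrictCLM (Sp d) ℝ ℝ volume 2 Uᶜ z.fst = 0) (isClosed_eq
        ((ContinuousLinearMap.continuous _).comp continuous_fst_L2Grad) continuous_const) ?_ hz
    rintro w ⟨φ, -, -, h3, h4, -⟩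
    rw [Lp_restrict_eq_zero_iff, ae_restrict_iff' hU.compl]
    filter_upwards [h4] with x hx hxU
    rw [hx]
    exact image_eq_zero_of_notMem_tsupport fun h => hxU (h3 h)
  rw [Lp_restrict_eq_zero_iff, ae_restrict_iff' hU.compl] at key
  exact key

theorem snd_ae_eq_zero_of_mem_H10 {U : Set (Sp d)} (hU : MeasurableSet U) {z : L2Grad d}
    (hz : z ∈ H10 U) : ∀ᵐ x, x ∉ U → z.snd x = 0 := by
  have key : LpToLpRestrictCLM (Sp d) (Sp d) ℝ volume 2 Uᶜ z.snd = 0 := by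
    refine H10_induction (p := fun z : L2Grad d =>
      LpToLpRestrictCLM (Sp d) (Sp d) ℝ volume 2 Uᶜ z.snd = 0) (isClosed_eq
        ((ContinuousLinearMap.continuous _).comp continuous_snd_L2Grad) continuous_const) ?_ hz
    rintro w ⟨φ, -, -, h3, -, h5⟩
    rw [Lp_restrict_eq_zero_iff, ae_restrict_iff' hU.compl]
    filter_upwards [h5] with x hx hxU
    rw [hx]
    exact image_eq_zero_of_notMem_tsupport fun h => hxU (h3 (tsupport_gradient_subset φ h))
  rw [Lp_restrict_eq_zero_iff, ae_restrict_iff' hU.compl] at key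
  exact key

/-- The derivative `b · ∇` as an operator on `L²` gradients. -/
def dirDeriv (b : Sp d) :
    Lp (Sp d) 2 (volume : Measure (Sp d)) →L[ℝ] Lp ℝ 2 (volume : Measure (Sp d)) :=
  (innerSL ℝ b).compLpL 2 volume

theorem coeFn_dirDeriv (b : Sp d) (g : Lp (Sp d) 2 (volume : Measure (Sp d))) :
    dirDeriv b g =ᵐ[volume] fun x => ⟪b, g x⟫ := by
  filter_upwards [(innerSL ℝ b).coeFn_compLpL (p := 2) g] with x hx
  rw [dirDeriv, hx, innerSL_apply_apply]

theorem norm_dirDeriv_le (b : Sp d) (g : Lp (Sp d) 2 (volume : Measure (Sp d))) :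
    ‖dirDeriv b g‖ ≤ ‖b‖ * ‖g‖ := by
  refine Lp.norm_le_mul_norm_of_ae_le_mul ?_
  filter_upwards [coeFn_dirDeriv b g] with x hx
  rw [hx]
  exact norm_inner_le_norm _ _

theorem inner_fst_dirDeriv (b : Sp d) (v u : L2Grad d) :
    ⟪v.fst, dirDeriv b u.snd⟫ = ∫ x, v.fst x * ⟪b, u.snd x⟫ := by
  rw [L2.inner_def]
  refine integral_congr_ae ?_
  filter_upwards [coeFn_dirDeriv b u.snd] with x hx
  rw [hx, real_inner_eq_re_inner ℝ]
  simp [mul_comm]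

theorem integrable_fst_mul_inner (b : Sp d) (v u : L2Grad d) :
    Integrable fun x => v.fst x * ⟪b, u.snd x⟫ := by
  refine (L2.integrable_inner (𝕜 := ℝ) v.fst (dirDeriv b u.snd)).congr ?_
  filter_upwards [coeFn_dirDeriv b u.snd] with x hx
  rw [hx, real_inner_eq_re_inner ℝ]
  simp [mul_comm]

/-- The form `∫ m ∇u · ∇v + v b · ∇u` over the whole space. -/
def globalForm (m : ℝ) (b : Sp d) (u v : L2Grad d) : ℝ :=
  m * ⟪u.snd, v.snd⟫ + ⟪v.fst, dirDeriv b u.snd⟫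

theorem globalForm_eq_integral (m : ℝ) (b : Sp d) (u v : L2Grad d) :
    globalForm m b u v = ∫ x, (m * ⟪u.snd x, v.snd x⟫ + v.fst x * ⟪b, u.snd x⟫) := by
  rw [globalForm, inner_fst_dirDeriv, L2.inner_def, integral_add
    ((L2.integrable_inner (𝕜 := ℝ) u.snd v.snd).const_mul m) (integrable_fst_mul_inner b v u),
    integral_const_mul]

/-- Each term of the integrand contains `v` or `∇v`, so only the test function has to live on `U`.
All the local problems can thus be written with one bilinear form on the whole space. -/
theorem aForm_eq_globalForm_of_right {U : Set (Sp d)} (hU : MeasurableSet U) (m : ℝ) (b : Sp d)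
    (u : L2Grad d) {v : L2Grad d} (hv : v ∈ H10 U) : aForm m b U u v = globalForm m b u v := by
  rw [globalForm_eq_integral, aForm, advForm]
  refine setIntegral_eq_integral_of_ae_compl_eq_zero ?_
  filter_upwards [fst_ae_eq_zero_of_mem_H10 hU hv, snd_ae_eq_zero_of_mem_H10 hU hv] with x h1 h2 hx
  rw [h1 hx, h2 hx]
  simp

/-- `globalForm` as a bilinear map. -/
def globalBilin (m : ℝ) (b : Sp d) : L2Grad d →ₗ[ℝ] L2Grad d →ₗ[ℝ] ℝ :=
  LinearMap.mk₂ ℝ (globalForm m b)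
    (fun u u' v => by
      simp only [globalForm, WithLp.add_snd, map_add, inner_add_left, inner_add_right]; ring)
    (fun c u v => by
      simp only [globalForm, WithLp.smul_snd, map_smul, real_inner_smul_left,
        real_inner_smul_right, smul_eq_mul]; ring)
    (fun u v v' => by
      simp only [globalForm, WithLp.add_snd, WithLp.add_fst, inner_add_left, inner_add_right]; ring)
    (fun c u v => by
      simp only [globalForm, WithLp.smul_snd, WithLp.smul_fst, real_inner_smul_left,
        real_inner_smul_right, smul_eq_mul]; ring)

@[simp]
theorem globalBilin_apply (m : ℝ) (b : Sp d) (u v : L2Grad d) :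
    globalBilin m b u v = globalForm m b u v := rfl

theorem norm_fst_le_L2Grad (z : L2Grad d) : ‖z.fst‖ ≤ ‖z‖ := by
  have := WithLp.prod_norm_sq_eq_of_L2 z
  exact abs_le_of_sq_le_sq' (by nlinarith [sq_nonneg ‖z.snd‖]) (norm_nonneg _) |>.2

theorem norm_snd_le_L2Grad (z : L2Grad d) : ‖z.snd‖ ≤ ‖z‖ := by
  have := WithLp.prod_norm_sq_eq_of_L2 z
  exact abs_le_of_sq_le_sq' (by nlinarith [sq_nonneg ‖z.fst‖]) (norm_nonneg _) |>.2

theorem abs_globalForm_le (m : ℝ) (b : Sp d) (u v : L2Grad d) :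
    |globalForm m b u v| ≤ (|m| + ‖b‖) * ‖u‖ * ‖v‖ := by
  have h1 : |⟪u.snd, v.snd⟫| ≤ ‖u‖ * ‖v‖ := (abs_real_inner_le_norm _ _).trans
    (mul_le_mul (norm_snd_le_L2Grad u) (norm_snd_le_L2Grad v) (norm_nonneg _) (norm_nonneg _))
  have h2 : |⟪v.fst, dirDeriv b u.snd⟫| ≤ ‖v‖ * (‖b‖ * ‖u‖) :=
    (abs_real_inner_le_norm _ _).trans
      (mul_le_mul (norm_fst_le_L2Grad v) ((norm_dirDeriv_le _ _).trans
        (mul_le_mul_of_nonneg_left (norm_snd_le_L2Grad u) (norm_nonneg _)))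
        (norm_nonneg _) (norm_nonneg _))
  calc |globalForm m b u v| ≤ |m * ⟪u.snd, v.snd⟫| + |⟪v.fst, dirDeriv b u.snd⟫| := abs_add_le _ _
    _ ≤ |m| * (‖u‖ * ‖v‖) + ‖v‖ * (‖b‖ * ‖u‖) := by
      rw [abs_mul]
      exact add_le_add (mul_le_mul_of_nonneg_left h1 (abs_nonneg _)) h2
    _ = _ := by ring

theorem integrable_of_hasCompactSupport_mul {f g : Sp d → ℝ} (hf : Continuous f) (hg : Continuous g)
    (hc : HasCompactSupport f) : Integrable fun x => f x * g x :=
  (hf.mul hg).integrable_of_hasCompactSupport hc.mul_right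

theorem integral_mul_inner_gradient {φ ψ : Sp d → ℝ} (hφ : ContDiff ℝ ∞ φ) (hψ : ContDiff ℝ ∞ ψ)
    (hc : HasCompactSupport φ) (c : Sp d) :
    ∫ x, φ x * ⟪c, gradient ψ x⟫ = -∫ x, ψ x * ⟪c, gradient φ x⟫ := by
  have hφ' : Continuous fun x => fderiv ℝ φ x c :=
    (hφ.continuous_fderiv (by simp)).clm_apply continuous_const
  have hψ' : Continuous fun x => fderiv ℝ ψ x c :=
    (hψ.continuous_fderiv (by simp)).clm_apply continuous_const
  have := integral_mul_fderiv_eq_neg_fderiv_mul_of_integrable (μ := (volume : Measure (Sp d)))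
    (f := φ) (g := ψ) (v := c)
    (integrable_of_hasCompactSupport_mul hφ' hψ.continuous (hc.fderiv_apply ℝ c))
    (integrable_of_hasCompactSupport_mul hφ.continuous hψ' hc)
    (integrable_of_hasCompactSupport_mul hφ.continuous hψ.continuous hc)
    (fun x _ => hφ.differentiable (by simp) x) (fun x _ => hψ.differentiable (by simp) x)
  simp only [inner_gradient]
  rw [this]
  simp only [mul_comm]

/-- Integration by parts with the constant, hence divergence-free, field `b`, extended by density in
one argument and then in the other. -/
theorem inner_fst_dirDeriv_antisymm {U : Set (Sp d)} (b : Sp d) {u v : L2Grad d} (hu : u ∈ H10 U)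
    (hv : v ∈ H10 U) : ⟪v.fst, dirDeriv b u.snd⟫ = -⟪u.fst, dirDeriv b v.snd⟫ := by
  have hcd : Continuous fun z : L2Grad d => dirDeriv b z.snd :=
    (dirDeriv b).continuous.comp continuous_snd_L2Grad
  refine H10_induction (p := fun z : L2Grad d =>
    ⟪v.fst, dirDeriv b z.snd⟫ = -⟪z.fst, dirDeriv b v.snd⟫)
    (isClosed_eq (continuous_const.inner hcd)
      (continuous_fst_L2Grad.inner continuous_const).neg) ?_ hu
  intro z hz
  refine H10_induction (p := fun v : L2Grad d =>
    ⟪v.fst, dirDeriv b z.snd⟫ = -⟪z.fst, dirDeriv b v.snd⟫)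
    (isClosed_eq (continuous_fst_L2Grad.inner continuous_const)
      (continuous_const.inner hcd).neg) ?_ hv
  intro w hw
  obtain ⟨φ, h1, h2, -, h4, h5⟩ := hz
  obtain ⟨ψ, k1, k2, -, k4, k5⟩ := hw
  rw [inner_fst_dirDeriv, inner_fst_dirDeriv]
  have e1 : ∫ x, w.fst x * ⟪b, z.snd x⟫ = ∫ x, ψ x * ⟪b, gradient φ x⟫ := by
    refine integral_congr_ae ?_
    filter_upwards [h5, k4] with x h k
    rw [h, k]
  have e2 : ∫ x, z.fst x * ⟪b, w.snd x⟫ = ∫ x, φ x * ⟪b, gradient ψ x⟫ := by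
    refine integral_congr_ae ?_
    filter_upwards [h4, k5] with x h k
    rw [h, k]
  rw [e1, e2, integral_mul_inner_gradient k1 h1 k2]

theorem inner_fst_dirDeriv_self {U : Set (Sp d)} (b : Sp d) {u : L2Grad d} (hu : u ∈ H10 U) :
    ⟪u.fst, dirDeriv b u.snd⟫ = 0 := by
  have := inner_fst_dirDeriv_antisymm b hu hu
  linarith

theorem globalForm_self {U : Set (Sp d)} (m : ℝ) (b : Sp d) {u : L2Grad d} (hu : u ∈ H10 U) :
    globalForm m b u u = m * ‖u.snd‖ ^ 2 := by
  rw [globalForm, inner_fst_dirDeriv_self b hu, add_zero, real_inner_self_eq_norm_sq]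

/-- Integration by parts against the constant `1`. This removes diffusion from the pairing of affine
functions with bubbles, and later separates `V_H` from the bubbles. -/
theorem setIntegral_inner_snd_eq_zero {U : Set (Sp d)} (hU : MeasurableSet U)
    (hU' : volume U ≠ ⊤) (c : Sp d) {z : L2Grad d} (hz : z ∈ H10 U) :
    ∫ x in U, ⟪c, z.snd x⟫ = 0 := by
  rw [← L2.inner_indicatorConstLp_eq_setIntegral_inner ℝ z.snd hU c hU']
  refine H10_induction (p := fun z : L2Grad d => ⟪indicatorConstLp 2 hU hU' c, z.snd⟫ = 0)
    (isClosed_eq (continuous_const.inner continuous_snd_L2Grad) continuous_const) ?_ hz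
  rintro w ⟨φ, h1, h2, h3, h4, h5⟩
  rw [L2.inner_indicatorConstLp_eq_setIntegral_inner ℝ w.snd hU c hU']
  have e : ∫ x in U, ⟪c, w.snd x⟫ = ∫ x, (1 : ℝ) * ⟪c, gradient φ x⟫ := by
    rw [setIntegral_eq_integral_of_ae_compl_eq_zero]
    · refine integral_congr_ae ?_
      filter_upwards [h5] with x h
      rw [h, one_mul]
    · filter_upwards [snd_ae_eq_zero_of_mem_H10 hU
        (testGraph_subset_H10 U ⟨φ, h1, h2, h3, h4, h5⟩)] with x h hx
      rw [h hx, inner_zero_right]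
  rw [e, ← neg_eq_iff_eq_neg.mpr (integral_mul_inner_gradient h1
    (contDiff_const (c := (1 : ℝ))) h2 c)]
  simp [gradient]

end

/-! ### Poincaré inequality, Lax–Milgram, and mollification of Lipschitz functions -/

section

variable {d : ℕ}

theorem Lp_two_norm_sq {E : Type*} [NormedAddCommGroup E] [InnerProductSpace ℝ E]
    (f : Lp E 2 (volume : Measure (Sp d))) : ‖f‖ ^ 2 = ∫ x, ‖f x‖ ^ 2 := by
  rw [← real_inner_self_eq_norm_sq, L2.inner_def]
  simp only [real_inner_self_eq_norm_sq]

theorem Lp_two_integrable_norm_sq {E : Type*} [NormedAddCommGroup E] [InnerProductSpace ℝ E]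
    (f : Lp E 2 (volume : Measure (Sp d))) : Integrable fun x => ‖f x‖ ^ 2 := by
  simpa only [real_inner_self_eq_norm_sq] using L2.integrable_inner (𝕜 := ℝ) f f

/-- Young's inequality, weighted so that half of `p ^ 2` can be absorbed in the Poincaré estimate.
-/
theorem neg_mul_le_of_abs_le {ξ p D G R : ℝ} (h1 : |ξ| ≤ R) (h2 : |D| ≤ G) :
    -(ξ * (2 * p * D)) ≤ 1 / 2 * p ^ 2 + 2 * R ^ 2 * G ^ 2 := by
  have h4 : |ξ * D| ≤ R * G := by
    rw [abs_mul]
    exact mul_le_mul h1 h2 (abs_nonneg _) ((abs_nonneg _).trans h1)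
  have h5 : (ξ * D) ^ 2 ≤ (R * G) ^ 2 := sq_le_sq' (abs_le.mp h4).1 (abs_le.mp h4).2
  nlinarith [sq_nonneg (p + 2 * (ξ * D))]

/-- The Poincaré inequality for smooth functions with compact support. -/
theorem integral_sq_le_of_contDiff (hd : 1 ≤ d) {R : ℝ} {φ : Sp d → ℝ} (hφ : ContDiff ℝ ∞ φ)
    (hc : HasCompactSupport φ) (hR : ∀ x ∈ tsupport φ, ‖x‖ ≤ R) :
    ∫ x, φ x ^ 2 ≤ 4 * R ^ 2 * ∫ x, ‖gradient φ x‖ ^ 2 := by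
  obtain ⟨e, he⟩ : ∃ e : Sp d, ‖e‖ = 1 := ⟨EuclideanSpace.single ⟨0, hd⟩ 1, by simp⟩
  have hξ : ContDiff ℝ ∞ fun x : Sp d => ⟪e, x⟫ := contDiff_const.inner ℝ contDiff_id
  have hξ' : ∀ x, ⟪e, gradient (fun x : Sp d => ⟪e, x⟫) x⟫ = 1 := fun x => by
    have h : HasFDerivAt (fun x : Sp d => ⟪e, x⟫) (innerSL ℝ e) x := (innerSL ℝ e).hasFDerivAt
    rw [inner_gradient, h.fderiv, innerSL_apply_apply, real_inner_self_eq_norm_sq, he, one_pow]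
  have h2 : ContDiff ℝ ∞ fun x => φ x ^ 2 := hφ.pow 2
  have hc2 : HasCompactSupport fun x => φ x ^ 2 :=
    hc.comp_left (g := fun t : ℝ => t ^ 2) (by simp)
  have hd2 : ∀ x, ⟪e, gradient (fun x => φ x ^ 2) x⟫ = 2 * φ x * ⟪e, gradient φ x⟫ := by
    intro x
    have h : fderiv ℝ (fun x => φ x ^ 2) x = (2 * φ x) • fderiv ℝ φ x := by
      simpa using ((hφ.differentiable (by simp) x).hasFDerivAt.pow 2).fderiv
    rw [inner_gradient, inner_gradient, h, smul_apply, smul_eq_mul]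
  -- The linear function `⟪e, x⟫` has derivative `1` along `e`, so `∫ φ²` equals `-∫ ⟪e, x⟫ 2 φ
  -- ∂ₑφ`, and `|⟪e, x⟫| ≤ R` on the support.
  have key := integral_mul_inner_gradient h2 hξ hc2 e
  simp only [hd2, hξ', mul_one] at key
  have hi1 : Integrable fun x => φ x ^ 2 :=
    (hφ.continuous.pow 2).integrable_of_hasCompactSupport hc2
  have hg := continuous_gradient hφ
  have hcg : HasCompactSupport fun x => ‖gradient φ x‖ ^ 2 :=
    HasCompactSupport.comp_left (g := fun t : ℝ => t ^ 2) (hasCompactSupport_gradient hc).norm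
      (by simp)
  have hi2 : Integrable fun x => ‖gradient φ x‖ ^ 2 :=
    (hg.norm.pow 2).integrable_of_hasCompactSupport hcg
  have hi3 : Integrable fun x => ⟪e, x⟫ * (2 * φ x * ⟪e, gradient φ x⟫) := by
    refine Continuous.integrable_of_hasCompactSupport (hξ.continuous.mul
      ((continuous_const.mul hφ.continuous).mul (continuous_const.inner hg))) ?_
    exact HasCompactSupport.mul_left (HasCompactSupport.mul_right
      (HasCompactSupport.mul_left (f := fun _ => (2 : ℝ)) hc))
  have hle : -∫ x, ⟪e, x⟫ * (2 * φ x * ⟪e, gradient φ x⟫) ≤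
      ∫ x, ((1 / 2 : ℝ) * φ x ^ 2 + 2 * R ^ 2 * ‖gradient φ x‖ ^ 2) := by
    rw [← integral_neg]
    refine integral_mono hi3.neg ((hi1.const_mul _).add (hi2.const_mul _)) fun x => ?_
    by_cases hx : x ∈ tsupport φ
    · refine neg_mul_le_of_abs_le ?_ ?_
      · have := abs_real_inner_le_norm e x
        rw [he, one_mul] at this
        exact this.trans (hR x hx)
      · have := abs_real_inner_le_norm e (gradient φ x)
        rwa [he, one_mul] at this
    · rw [image_eq_zero_of_notMem_tsupport hx, mul_zero, zero_mul, mul_zero, neg_zero]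
      positivity
  rw [integral_add (hi1.const_mul _) (hi2.const_mul _), integral_const_mul, integral_const_mul]
    at hle
  linarith

/-- The Poincaré inequality on `H¹₀(U)` for a bounded set `U`. -/
theorem poincare_H10 (hd : 1 ≤ d) {U : Set (Sp d)} {R : ℝ} (hR : ∀ x ∈ U, ‖x‖ ≤ R) {z : L2Grad d}
    (hz : z ∈ H10 U) : ‖z.fst‖ ^ 2 ≤ 4 * R ^ 2 * ‖z.snd‖ ^ 2 := by
  refine H10_induction (p := fun z : L2Grad d => ‖z.fst‖ ^ 2 ≤ 4 * R ^ 2 * ‖z.snd‖ ^ 2)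
    (isClosed_le (continuous_fst_L2Grad.norm.pow 2)
      (continuous_const.mul (continuous_snd_L2Grad.norm.pow 2))) ?_ hz
  rintro w ⟨φ, h1, h2, h3, h4, h5⟩
  rw [Lp_two_norm_sq, Lp_two_norm_sq]
  have e1 : ∫ x, ‖w.fst x‖ ^ 2 = ∫ x, φ x ^ 2 := by
    refine integral_congr_ae ?_
    filter_upwards [h4] with x h
    rw [h, Real.norm_eq_abs, sq_abs]
  have e2 : ∫ x, ‖w.snd x‖ ^ 2 = ∫ x, ‖gradient φ x‖ ^ 2 := by
    refine integral_congr_ae ?_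
    filter_upwards [h5] with x h
    rw [h]
  rw [e1, e2]
  exact integral_sq_le_of_contDiff hd h1 h2 fun x hx => hR x (h3 hx)

theorem eq_zero_of_mem_H10_of_snd_eq_zero (hd : 1 ≤ d) {U : Set (Sp d)}
    (hU : Bornology.IsBounded U) {z : L2Grad d} (hz : z ∈ H10 U) (h : z.snd = 0) : z = 0 := by
  obtain ⟨R, hR⟩ := hU.exists_norm_le
  have := poincare_H10 hd hR hz
  rw [h, norm_zero] at this
  have h0 : z.fst = 0 := by
    rw [← norm_eq_zero]
    nlinarith [norm_nonneg z.fst]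
  exact WithLp.ofLp_injective 2 (Prod.ext h0 h)

theorem eq_zero_of_globalForm_self_eq_zero (hd : 1 ≤ d) {U : Set (Sp d)}
    (hU : Bornology.IsBounded U) {m : ℝ} (hm : 0 < m) (b : Sp d) {z : L2Grad d} (hz : z ∈ H10 U)
    (h : globalForm m b z z = 0) : z = 0 := by
  rw [globalForm_self m b hz] at h
  refine eq_zero_of_mem_H10_of_snd_eq_zero hd hU hz ?_
  simpa [hm.ne'] using h

/-- Existence and uniqueness for the variational problem on a complete subspace of `H¹₀(U)`. -/
theorem existsUnique_variational (hd : 1 ≤ d) {U : Set (Sp d)} (hU : Bornology.IsBounded U)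
    {m : ℝ} (hm : 0 < m) (b : Sp d) {W : Submodule ℝ (L2Grad d)} [CompleteSpace W] (hW : W ≤ H10 U)
    (l : L2Grad d →L[ℝ] ℝ) : ∃! u, u ∈ W ∧ ∀ v ∈ W, globalForm m b u v = l v := by
  obtain ⟨R, hR⟩ := hU.exists_norm_le
  let A : W →L[ℝ] W →L[ℝ] ℝ := LinearMap.mkContinuous₂
    ((globalBilin m b).domRestrict₁₂ W W) (|m| + ‖b‖) fun u v => abs_globalForm_le m b u v
  have hA : ∀ u v : W, A u v = globalForm m b u v := fun u v => rfl
  have hco : IsCoercive A := by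
    -- By Poincaré, `‖u‖² = ‖u.fst‖² + ‖u.snd‖² ≤ (4R² + 1) ‖u.snd‖²`, while the form on the
    -- diagonal is `m ‖u.snd‖²`.
    refine ⟨m / (4 * R ^ 2 + 1), by positivity, fun u => ?_⟩
    rw [hA, globalForm_self m b (hW u.2)]
    have h1 := poincare_H10 hd hR (hW u.2)
    have h2 := WithLp.prod_norm_sq_eq_of_L2 (u : L2Grad d)
    have h3 : ‖u‖ * ‖u‖ ≤ (4 * R ^ 2 + 1) * ‖(u : L2Grad d).snd‖ ^ 2 := by
      rw [← pow_two, Submodule.coe_norm, h2]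
      linarith
    calc m / (4 * R ^ 2 + 1) * ‖u‖ * ‖u‖ = m / (4 * R ^ 2 + 1) * (‖u‖ * ‖u‖) := by ring
      _ ≤ m / (4 * R ^ 2 + 1) * ((4 * R ^ 2 + 1) * ‖(u : L2Grad d).snd‖ ^ 2) := by gcongr
      _ = m * ‖(u : L2Grad d).snd‖ ^ 2 := by field_simp
  let f : W := (InnerProductSpace.toDual ℝ W).symm (l.comp W.subtypeL)
  let u : W := hco.continuousLinearEquivOfBilin.symm f
  refine ⟨u, ⟨u.2, fun v hv => ?_⟩, ?_⟩
  · have h1 := hco.continuousLinearEquivOfBilin_apply u ⟨v, hv⟩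
    rw [hA] at h1
    rw [← h1, ContinuousLinearEquiv.apply_symm_apply,
      InnerProductSpace.toDual_symm_apply]
    rfl
  · rintro w ⟨hw, hw'⟩
    have hdiff : w - u ∈ W := W.sub_mem hw u.2
    have hu : globalForm m b u (w - u) = l (w - u) := by
      have h1 := hco.continuousLinearEquivOfBilin_apply u ⟨_, hdiff⟩
      rw [hA] at h1
      rw [← h1, ContinuousLinearEquiv.apply_symm_apply,
        InnerProductSpace.toDual_symm_apply]
      rfl
    have : globalForm m b (w - u) (w - u) = 0 := by
      rw [← globalBilin_apply, LinearMap.map_sub₂, globalBilin_apply, globalBilin_apply,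
        hu, hw' _ hdiff, sub_self]
    exact sub_eq_zero.mp (eq_zero_of_globalForm_self_eq_zero hd hU hm b (hW hdiff) this)

/-- Dominated convergence in `L²`. -/
theorem tendsto_Lp_two_of_dominated {E : Type*} [NormedAddCommGroup E] [InnerProductSpace ℝ E]
    {f : ℕ → Lp E 2 (volume : Measure (Sp d))} {g : Lp E 2 (volume : Measure (Sp d))}
    {F : Sp d → ℝ} (hF : MemLp F 2 (volume : Measure (Sp d))) (hf : ∀ n, ∀ᵐ x, ‖f n x‖ ≤ F x)
    (h : ∀ᵐ x, Tendsto (fun n => f n x) atTop (𝓝 (g x))) : Tendsto f atTop (𝓝 g) := by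
  rw [tendsto_iff_norm_sub_tendsto_zero]
  have hsq : Tendsto (fun n => ‖f n - g‖ ^ 2) atTop (𝓝 0) := by
    simp only [Lp_two_norm_sq]
    have : ∫ _ : Sp d, (0 : ℝ) = 0 := by simp
    rw [← this]
    refine tendsto_integral_of_dominated_convergence (fun x => (2 * F x) ^ 2)
      (fun n => (Lp_two_integrable_norm_sq _).1) (hF.const_mul 2).integrable_sq (fun n => ?_) ?_
    · filter_upwards [Lp.coeFn_sub (f n) g, hf n, ae_all_iff.mpr hf, h] with x h1 h2 h3 h4
      have h5 : ‖g x‖ ≤ F x := le_of_tendsto h4.norm (Eventually.of_forall h3)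
      rw [h1, Pi.sub_apply, norm_pow, norm_norm]
      have := norm_sub_le (f n x) (g x)
      gcongr
      linarith
    · filter_upwards [ae_all_iff.mpr fun n => Lp.coeFn_sub (f n) g, h] with x h1 h2
      simp only [h1, Pi.sub_apply]
      have := ((h2.sub_const (g x)).norm.pow 2)
      simpa using this
  have := hsq.sqrt
  simpa [Real.sqrt_sq (norm_nonneg _)] using this

theorem mem_H10_of_dominated {U : Set (Sp d)} {f : ℕ → L2Grad d} {g : L2Grad d}
    (hf : ∀ n, f n ∈ H10 U) {F : Sp d → ℝ} (hF : MemLp F 2 (volume : Measure (Sp d)))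
    (h1 : ∀ n, ∀ᵐ x, ‖(f n).fst x‖ ≤ F x) (h2 : ∀ n, ∀ᵐ x, ‖(f n).snd x‖ ≤ F x)
    (h3 : ∀ᵐ x, Tendsto (fun n => (f n).fst x) atTop (𝓝 (g.fst x)))
    (h4 : ∀ᵐ x, Tendsto (fun n => (f n).snd x) atTop (𝓝 (g.snd x))) : g ∈ H10 U := by
  refine (isClosed_H10 U).mem_of_tendsto (f := f) (b := atTop) ?_ (Eventually.of_forall hf)
  have := (tendsto_Lp_two_of_dominated hF h1 h3).prodMk_nhds (tendsto_Lp_two_of_dominated hF h2 h4)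
  exact ((WithLp.prod_continuous_toLp 2 _ _).tendsto _).comp this

theorem convolution_eq_integral (ρ : Sp d → ℝ) {E : Type*} [NormedAddCommGroup E]
    [NormedSpace ℝ E] (g : Sp d → E) (x : Sp d) :
    (convolution ρ g (ContinuousLinearMap.lsmul ℝ ℝ) volume) x = ∫ t, ρ t • g (x - t) := rfl

/-- Differentiation under the integral with the derivative falling on `g`: Rademacher's theorem
gives differentiability almost everywhere, and the Lipschitz constant gives the domination. The
gradient of a mollification is then a mollified gradient. -/
theorem hasFDerivAt_convolution_of_lipschitz {ρ g : Sp d → ℝ} {C : NNReal} (hρ : Continuous ρ)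
    (hρc : HasCompactSupport ρ) (hg : LipschitzWith C g) (x : Sp d) :
    HasFDerivAt (convolution ρ g (ContinuousLinearMap.lsmul ℝ ℝ) volume)
      ((convolution ρ (fderiv ℝ g) (ContinuousLinearMap.lsmul ℝ ℝ) volume) x) x := by
  have hcont : ∀ y : Sp d, Continuous fun t => ρ t • g (y - t) := fun y =>
    hρ.smul (hg.continuous.comp (continuous_const.sub continuous_id))
  refine (hasFDerivAt_integral_of_dominated_loc_of_lip (F := fun y t => ρ t • g (y - t))
    (F' := fun t => ρ t • fderiv ℝ g (x - t)) (bound := fun t => ρ t * C) (s := univ) univ_mem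
    (Eventually.of_forall fun y => (hcont y).aestronglyMeasurable)
    ((hcont x).integrable_of_hasCompactSupport hρc.smul_right) ?_ ?_ ?_ ?_).2
  · refine hρ.aestronglyMeasurable.smul ?_
    exact ((measurable_fderiv ℝ g).comp (measurable_const.sub measurable_id)).aestronglyMeasurable
  · refine Eventually.of_forall fun t => LipschitzWith.lipschitzOnWith ?_
    refine LipschitzWith.of_dist_le_mul fun y z => ?_
    have := hg.dist_le_mul (y - t) (z - t)
    rw [dist_sub_right] at this
    rw [dist_smul₀, Real.norm_eq_abs]
    simp only [Real.coe_nnabs, abs_mul, NNReal.abs_eq, mul_assoc]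
    gcongr
  · exact (hρ.mul continuous_const).integrable_of_hasCompactSupport hρc.mul_right
  · have h := (Measure.measurePreserving_sub_left (volume : Measure (Sp d))
      x).quasiMeasurePreserving.ae hg.ae_differentiableAt
    filter_upwards [h] with t ht
    have h1 : HasFDerivAt (fun y : Sp d => g (y - t)) (fderiv ℝ g (x - t)) x := by
      simpa [Function.comp_def] using
        ht.hasFDerivAt.comp x ((hasFDerivAt_id x).sub_const t)
    exact h1.const_smul (ρ t)

theorem norm_gradient (g : Sp d → ℝ) (x : Sp d) : ‖gradient g x‖ = ‖fderiv ℝ g x‖ := by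
  rw [gradient, LinearIsometryEquiv.norm_map]

theorem aestronglyMeasurable_gradient (g : Sp d → ℝ) :
    AEStronglyMeasurable (gradient g) (volume : Measure (Sp d)) :=
  (InnerProductSpace.toDual ℝ (Sp d)).symm.continuous.comp_aestronglyMeasurable
    (measurable_fderiv ℝ g).aestronglyMeasurable

theorem memLp_two_indicator_const {S : Set (Sp d)} (hS : IsCompact S) (c : ℝ) :
    MemLp (S.indicator fun _ => c) 2 (volume : Measure (Sp d)) :=
  MeasureTheory.memLp_indicator_const 2 hS.measurableSet c (Or.inr hS.measure_lt_top.ne)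

/-- A Lipschitz function with compact support in `U` belongs to `H¹₀(U)`. -/
theorem mem_H10_of_lipschitz {U : Set (Sp d)} (hU : IsOpen U) {g : Sp d → ℝ} {C : NNReal}
    (hg : LipschitzWith C g) (hc : HasCompactSupport g) (hs : tsupport g ⊆ U) {w : L2Grad d}
    (h1 : w.fst =ᵐ[volume] g) (h2 : w.snd =ᵐ[volume] gradient g) : w ∈ H10 U := by
  obtain ⟨δ, hδ, hδU⟩ := hc.exists_cthickening_subset_open hU hs
  let S : Set (Sp d) := Metric.cthickening δ (tsupport g)
  have hS : IsCompact S := hc.isCompact.cthickening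
  have hpos : ∀ n : ℕ, 0 < δ / (n + 2) / 2 := fun n => by positivity
  -- The shift in `n + 2` keeps the outer radius strictly below `δ` from `n = 0` on; the fixed ratio
  -- 2 of the radii is what the Lebesgue differentiation argument below requires.
  let φ : ℕ → ContDiffBump (0 : Sp d) := fun n =>
    ⟨δ / (n + 2) / 2, δ / (n + 2), hpos n, half_lt_self (by positivity)⟩
  have hr : ∀ n, (φ n).rOut = δ / (n + 2) := fun n => rfl
  have hrδ : ∀ n, (φ n).rOut < δ := fun n => by
    rw [hr]
    exact div_lt_self hδ (by linarith [(Nat.cast_nonneg n : (0 : ℝ) ≤ n)])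
  have hr0 : Tendsto (fun n => (φ n).rOut) atTop (𝓝 0) := by
    simp only [hr]
    exact tendsto_const_nhds.div_atTop
      (tendsto_atTop_add_const_right _ _ tendsto_natCast_atTop_atTop)
  let gn : ℕ → Sp d → ℝ := fun n =>
    convolution ((φ n).normed volume) g (ContinuousLinearMap.lsmul ℝ ℝ) volume
  have hgi : LocallyIntegrable g volume := hg.continuous.locallyIntegrable
  have hcd : ∀ n, ContDiff ℝ ∞ (gn n) := fun n =>
    (φ n).hasCompactSupport_normed.contDiff_convolution_left _ (φ n).contDiff_normed hgi
  have hsupp : ∀ n, tsupport (gn n) ⊆ S := fun n => by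
    refine closure_minimal ?_ Metric.isClosed_cthickening
    refine (support_convolution_subset _).trans ?_
    rw [(φ n).support_normed_eq]
    rintro _ ⟨a, ha, t, ht, rfl⟩
    refine Metric.mem_cthickening_of_dist_le _ t _ _ (subset_tsupport _ ht) ?_
    have : ‖a‖ < (φ n).rOut := by simpa using ha
    rw [dist_eq_norm]
    simpa using (this.trans (hrδ n)).le
  have hcs : ∀ n, HasCompactSupport (gn n) := fun n =>
    hS.of_isClosed_subset (isClosed_tsupport _) (hsupp n)
  choose wn hwn hwn1 hwn2 using fun n =>
    exists_mem_testGraph (U := U) (hcd n) (hcs n) ((hsupp n).trans hδU)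
  obtain ⟨M, hM⟩ := hg.continuous.bounded_above_of_compact_support hc
  have hM0 : 0 ≤ M := (norm_nonneg _).trans (hM 0)
  have hdist : ∀ n x, dist (gn n x) (g x) ≤ C * (φ n).rOut := fun n x => by
    refine (φ n).dist_normed_convolution_le hg.continuous.aestronglyMeasurable fun y hy => ?_
    refine (hg.dist_le_mul y x).trans ?_
    gcongr
    exact (Metric.mem_ball.mp hy).le
  have hfd : ∀ n x, fderiv ℝ (gn n) x = (convolution ((φ n).normed volume) (fderiv ℝ g)
      (ContinuousLinearMap.lsmul ℝ ℝ) volume) x := fun n x =>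
    (hasFDerivAt_convolution_of_lipschitz (φ n).continuous_normed
      (φ n).hasCompactSupport_normed hg x).fderiv
  have hfdb : ∀ n x, ‖fderiv ℝ (gn n) x‖ ≤ C := fun n x => by
    rw [hfd, convolution_eq_integral]
    have hb : ∀ t, ‖(φ n).normed volume t • fderiv ℝ g (x - t)‖ ≤ (φ n).normed volume t * C :=
      fun t => by
        rw [norm_smul, Real.norm_eq_abs, abs_of_nonneg ((φ n).nonneg_normed t)]
        exact mul_le_mul_of_nonneg_left (norm_fderiv_le_of_lipschitz ℝ hg) ((φ n).nonneg_normed t)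
    refine (norm_integral_le_of_norm_le ((φ n).integrable_normed.mul_const _)
      (Eventually.of_forall hb)).trans ?_
    rw [integral_mul_const, (φ n).integral_normed, one_mul]
  -- The gradient is merely bounded and measurable, so its mollifications converge only at almost
  -- every point; dominated convergence turns this into `L²` convergence.
  have hae := ContDiffBump.ae_convolution_tendsto_right_of_locallyIntegrable (φ := φ)
    (g := fderiv ℝ g) (μ := (volume : Measure (Sp d))) (K := 2) hr0
    (Eventually.of_forall fun n => by
      change δ / (n + 2) ≤ 2 * (δ / (n + 2) / 2); linarith) (by
      refine (memLp_top_of_bound (measurable_fderiv ℝ g).aestronglyMeasurable C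
        (Eventually.of_forall fun x => norm_fderiv_le_of_lipschitz ℝ hg)).locallyIntegrable le_top)
  refine mem_H10_of_dominated (f := wn) (fun n => testGraph_subset_H10 U (hwn n))
    (memLp_two_indicator_const hS (M + C * δ + C)) (fun n => ?_) (fun n => ?_) ?_ ?_
  · filter_upwards [hwn1 n] with x hx
    rw [hx]
    by_cases hxS : x ∈ S
    · rw [indicator_of_mem hxS]
      have h3 := (hdist n x).trans (mul_le_mul_of_nonneg_left (hrδ n).le C.2)
      have h4 := norm_le_norm_add_norm_sub' (gn n x) (g x)
      rw [← dist_eq_norm] at h4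
      have := hM x
      have := C.2
      have h5 : ((C : ℝ) * δ) = C.1 * δ := rfl
      have h6 : (C : ℝ) = C.1 := rfl
      linarith
    · rw [indicator_of_notMem hxS, image_eq_zero_of_notMem_tsupport fun h => hxS (hsupp n h),
        norm_zero]
  · filter_upwards [hwn2 n] with x hx
    rw [hx]
    by_cases hxS : x ∈ S
    · rw [indicator_of_mem hxS, norm_gradient]
      have : 0 ≤ (C : ℝ) * δ := by positivity
      linarith [hfdb n x]
    · rw [indicator_of_notMem hxS, image_eq_zero_of_notMem_tsupport fun h =>
        hxS (hsupp n (tsupport_gradient_subset _ h)), norm_zero]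
  · filter_upwards [ae_all_iff.mpr hwn1, h1] with x hx hx'
    simp only [hx, hx']
    rw [tendsto_iff_dist_tendsto_zero]
    refine squeeze_zero (fun n => dist_nonneg) (fun n => hdist n x) ?_
    simpa using hr0.const_mul (C : ℝ)
  · filter_upwards [ae_all_iff.mpr hwn2, h2, hae] with x hx hx' h
    simp only [hx, hx', gradient, hfd]
    exact ((InnerProductSpace.toDual ℝ (Sp d)).symm.continuous.tendsto _).comp h

end

/-! ### Barycentric coordinates, and Lipschitz functions vanishing outside an open set -/

section

variable {d : ℕ}

theorem coeFn_finset_sum {ι E : Type*} [NormedAddCommGroup E] (s : Finset ι)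
    (f : ι → Lp E 2 (volume : Measure (Sp d))) :
    ⇑(∑ i ∈ s, f i) =ᵐ[volume] fun x => ∑ i ∈ s, f i x := by
  classical
  induction s using Finset.induction_on with
  | empty =>
    exact Eventually.of_forall fun x => by simp
  | insert i s hi ih =>
    rw [Finset.sum_insert hi]
    filter_upwards [Lp.coeFn_add (f i) (∑ i ∈ s, f i), ih] with x h1 h2
    rw [h1, Pi.add_apply, h2, Finset.sum_insert hi]

theorem isOpen_openSimplex (K : Finset (Sp d)) : IsOpen (openSimplex K) := isOpen_interior

theorem isBounded_openSimplex (K : Finset (Sp d)) : Bornology.IsBounded (openSimplex K) :=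
  (K.finite_toSet.isCompact_convexHull ℝ).isBounded.subset interior_subset

theorem isClosed_convexHull_finset (K : Finset (Sp d)) :
    IsClosed (convexHull ℝ (K : Set (Sp d))) :=
  (K.finite_toSet.isCompact_convexHull ℝ).isClosed

/-- The barycentric coordinates of a simplex of full dimension, extended by zero to points that
are not vertices. -/
theorem exists_barycentric {K : Finset (Sp d)} (hi : AffineIndependent ℝ ((↑) : K → Sp d))
    (hc : K.card = d + 1) : ∃ β : Sp d → Sp d →ᵃ[ℝ] ℝ, (∀ v ∉ K, β v = 0) ∧
      (∀ v ∈ K, β v v = 1) ∧ (∀ v, ∀ x ∈ K, x ≠ v → β v x = 0) ∧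
      (∀ x, x ∈ convexHull ℝ (K : Set (Sp d)) ↔ ∀ v ∈ K, 0 ≤ β v x) ∧
      (∀ x, x ∈ openSimplex K ↔ ∀ v ∈ K, 0 < β v x) ∧ K.centroid ℝ id ∈ openSimplex K := by
  classical
  have htot : affineSpan ℝ (range ((↑) : K → Sp d)) = ⊤ := by
    rw [hi.affineSpan_eq_top_iff_card_eq_finrank_add_one]
    simp [hc]
  let B : AffineBasis K ℝ (Sp d) := ⟨(↑), hi, htot⟩
  have hr : range B = (K : Set (Sp d)) := Subtype.range_coe
  obtain ⟨β, hβ⟩ : ∃ β : Sp d → Sp d →ᵃ[ℝ] ℝ,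
      ∀ v, β v = if h : v ∈ K then B.coord ⟨v, h⟩ else 0 := ⟨_, fun _ => rfl⟩
  refine ⟨β, fun v hv => (hβ v).trans (dif_neg hv), fun v hv => ?_,
    fun v x hx hxv => ?_, fun x => ?_, fun x => ?_, ?_⟩
  · rw [hβ, dif_pos hv]
    exact B.coord_apply_eq ⟨v, hv⟩
  · by_cases hv : v ∈ K
    · rw [hβ, dif_pos hv]
      exact B.coord_apply_ne (i := ⟨v, hv⟩) (j := ⟨x, hx⟩)
        fun h => hxv (congrArg Subtype.val h).symm
    · rw [hβ, dif_neg hv]; rfl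
  · rw [← hr, B.convexHull_eq_nonneg_coord]
    constructor
    · intro h v hv
      rw [hβ, dif_pos hv]
      exact h ⟨v, hv⟩
    · intro h i
      have := h i i.2
      rwa [hβ, dif_pos i.2] at this
  · rw [openSimplex, ← hr, B.interior_convexHull]
    constructor
    · intro h v hv
      rw [hβ, dif_pos hv]
      exact h ⟨v, hv⟩
    · intro h i
      have := h i i.2
      rwa [hβ, dif_pos i.2] at this
  · have := B.centroid_mem_interior_convexHull
    rw [hr] at this
    rw [openSimplex, ← Finset.centroid_univ]
    exact this

/-- A continuous function which is Lipschitz on each set of a finite closed cover is Lipschitz. -/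
theorem lipschitzWith_of_finite_closed_cover {E ι : Type*} [NormedAddCommGroup E] [NormedSpace ℝ E]
    [Finite ι] {S : ι → Set E} (hS : ∀ i, IsClosed (S i)) (hcov : ∀ x, ∃ i, x ∈ S i) {f : E → ℝ}
    (hf : Continuous f) {C : NNReal} (hC : ∀ i, LipschitzOnWith C f (S i)) : LipschitzWith C f := by
  refine LipschitzWith.of_le_add_mul _ fun y x => ?_
  let p : ℝ → E := fun t => x + t • (y - x)
  have hp : Continuous p := continuous_const.add (continuous_id.smul continuous_const)
  have hpd : ∀ s t, dist (p s) (p t) = |s - t| * dist y x := fun s t => by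
    simp only [p, dist_eq_norm]
    rw [add_sub_add_left_eq_sub, ← sub_smul, norm_smul, Real.norm_eq_abs]
  -- Restricted to the segment from `x` to `y`, `f` has right slopes bounded by `C * dist y x`,
  -- which controls its total increase.
  have key := image_le_of_liminf_slope_right_le_deriv_boundary (f := f ∘ p) (a := 0) (b := 1)
    (B := fun t => f x + t * (C * dist y x)) (B' := fun _ => C * dist y x)
    (hf.comp hp).continuousOn (by simp [p]) (by fun_prop) (fun t _ => by
      simpa using (((hasDerivAt_id t).mul_const (C * dist y x)).const_add (f x)).hasDerivWithinAt)
    (fun t _ r hr => by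
      refine Eventually.frequently ?_
      -- There are finitely many closed pieces, so a piece missing `p t` is also missed just after
      -- `t`. Any piece containing `p s` then contains `p t`, and its own Lipschitz bound applies.
      have h1 : ∀ᶠ s in 𝓝[>] t, ∀ i, p t ∉ S i → p s ∉ S i := by
        rw [eventually_all]
        intro i
        by_cases hi : p t ∈ S i
        · exact Eventually.of_forall fun s h => absurd hi h
        · have : ∀ᶠ s in 𝓝 t, p s ∉ S i :=
            hp.continuousAt.eventually ((hS i).isOpen_compl.mem_nhds hi)
          exact (this.filter_mono nhdsWithin_le_nhds).mono fun s hs _ => hs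
      filter_upwards [h1, self_mem_nhdsWithin] with s hs hst
      obtain ⟨i, hi⟩ := hcov (p s)
      have hti : p t ∈ S i := by
        by_contra h
        exact hs i h hi
      have hst' : 0 < s - t := sub_pos.mpr hst
      have h2 := (hC i).dist_le_mul _ hi _ hti
      rw [hpd, abs_of_pos hst'] at h2
      have h3 := (le_abs_self _).trans (Real.dist_eq (f (p s)) (f (p t)) ▸ h2)
      rw [slope_def_field, div_lt_iff₀ hst']
      simp only [Function.comp_apply]
      nlinarith) (right_mem_Icc.mpr zero_le_one)
  simpa [p] using key

/-- `t ↦ t - max (-ε) (min t ε)` vanishes on `[-ε, ε]` and is a translation elsewhere. -/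
def softThreshold (ε t : ℝ) : ℝ := t - max (-ε) (min t ε)

theorem softThreshold_eq_zero {ε t : ℝ} (h : |t| ≤ ε) : softThreshold ε t = 0 := by
  obtain ⟨h1, h2⟩ := abs_le.mp h
  rw [softThreshold, min_eq_left h2, max_eq_right h1, sub_self]

theorem softThreshold_of_lt {ε t : ℝ} (hε : 0 ≤ ε) (h : ε < t) : softThreshold ε t = t - ε := by
  rw [softThreshold, min_eq_right h.le, max_eq_right (by linarith)]

theorem softThreshold_of_lt_neg {ε t : ℝ} (hε : 0 ≤ ε) (h : t < -ε) :
    softThreshold ε t = t - (-ε) := by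
  rw [softThreshold, min_eq_left (by linarith), max_eq_left h.le]

theorem abs_softThreshold_sub_le {ε : ℝ} (hε : 0 ≤ ε) (t : ℝ) : |softThreshold ε t - t| ≤ ε := by
  rw [softThreshold, sub_sub_cancel_left, abs_neg, abs_le]
  exact ⟨le_max_left _ _, max_le (by linarith) (min_le_right _ _)⟩

theorem lipschitzWith_softThreshold (ε : ℝ) : LipschitzWith 2 (softThreshold ε) := by
  have h : LipschitzWith (1 + 1) fun t : ℝ => t - max (-ε) (min t ε) :=
    LipschitzWith.id.sub ((LipschitzWith.id.min_const ε).const_max (-ε))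
  rwa [one_add_one_eq_two] at h

/-- A Lipschitz function that vanishes outside a bounded open set `U`, and whose gradient vanishes
almost everywhere on its zero set, belongs to `H¹₀(U)`. -/
theorem mem_H10_of_lipschitz_of_eq_zero {U : Set (Sp d)} (hU : IsOpen U)
    (hUb : IsCompact (closure U)) {g : Sp d → ℝ} {C : NNReal} (hg : LipschitzWith C g)
    (h0 : ∀ x ∉ U, g x = 0) (hgr : ∀ᵐ x, g x = 0 → gradient g x = 0) {w : L2Grad d}
    (h1 : w.fst =ᵐ[volume] g) (h2 : w.snd =ᵐ[volume] gradient g) : w ∈ H10 U := by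
  let ε : ℕ → ℝ := fun n => 1 / ((n : ℝ) + 1)
  have hε : ∀ n, 0 < ε n := fun n => Nat.one_div_pos_of_nat
  have hε0 : Tendsto ε atTop (𝓝 0) := tendsto_one_div_add_atTop_nhds_zero_nat
  have hε1 : ∀ n, ε n ≤ 1 := fun n => by
    simp only [ε]
    rw [div_le_one (by positivity)]
    linarith [(Nat.cast_nonneg n : (0 : ℝ) ≤ n)]
  -- Thresholding confines the support to the closed set `{ε n ≤ |g|}`, which lies inside `U` since
  -- `g` vanishes off `U`. No regularity of the boundary is needed.
  let gn : ℕ → Sp d → ℝ := fun n => softThreshold (ε n) ∘ g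
  have hgn : ∀ n, LipschitzWith (2 * C) (gn n) := fun n =>
    (lipschitzWith_softThreshold (ε n)).comp hg
  have hts : ∀ n, tsupport (gn n) ⊆ U := fun n => by
    have h : tsupport (gn n) ⊆ {x | ε n ≤ |g x|} := by
      refine closure_minimal (fun x hx => ?_) (isClosed_le continuous_const hg.continuous.abs)
      by_contra h
      exact hx (softThreshold_eq_zero (not_le.mp h).le)
    intro x hx
    by_contra hxU
    have h' : ε n ≤ |g x| := h hx
    rw [h0 x hxU, abs_zero] at h'
    exact absurd (hε n) (not_lt.mpr h')
  have hcs : ∀ n, HasCompactSupport (gn n) := fun n =>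
    hUb.of_isClosed_subset (isClosed_tsupport _) ((hts n).trans subset_closure)
  have hzero : ∀ n, ∀ x ∉ closure U, gn n x = 0 := fun n x hx =>
    image_eq_zero_of_notMem_tsupport fun h => hx (subset_closure (hts n h))
  have hcg : HasCompactSupport g := HasCompactSupport.of_support_subset_isCompact hUb
    fun x hx => subset_closure (by_contra fun h => hx (h0 x h))
  obtain ⟨M, hM⟩ := hg.continuous.bounded_above_of_compact_support hcg
  have hM0 : 0 ≤ M := (norm_nonneg _).trans (hM 0)
  let F : Sp d → ℝ := (closure U).indicator fun _ => M + 1 + (2 * C : NNReal)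
  have hF : MemLp F 2 (volume : Measure (Sp d)) := memLp_two_indicator_const hUb _
  have hb1 : ∀ n x, ‖gn n x‖ ≤ F x := fun n x => by
    by_cases hx : x ∈ closure U
    · simp only [F]
      rw [indicator_of_mem hx]
      have h3 := abs_softThreshold_sub_le (hε n).le (g x)
      have h4 := norm_le_norm_add_norm_sub' (gn n x) (g x)
      have h5 : ‖gn n x - g x‖ ≤ ε n := h3
      have h6 : (0 : ℝ) ≤ (2 * C : NNReal) := NNReal.coe_nonneg _
      linarith [hM x, hε1 n]
    · rw [hzero n x hx, norm_zero]
      simp [F, hx]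
  have hb2 : ∀ n x, ‖gradient (gn n) x‖ ≤ F x := fun n x => by
    by_cases hx : x ∈ closure U
    · simp only [F]
      rw [indicator_of_mem hx, norm_gradient]
      linarith [norm_fderiv_le_of_lipschitz ℝ (hgn n) (x₀ := x)]
    · rw [image_eq_zero_of_notMem_tsupport fun h =>
        hx (subset_closure (hts n (tsupport_gradient_subset _ h))), norm_zero]
      simp [F, hx]
  have hm1 : ∀ n, MemLp (gn n) 2 (volume : Measure (Sp d)) := fun n =>
    hF.of_le (hgn n).continuous.aestronglyMeasurable
      (Eventually.of_forall fun x => (hb1 n x).trans (le_abs_self _))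
  have hm2 : ∀ n, MemLp (gradient (gn n)) 2 (volume : Measure (Sp d)) := fun n =>
    hF.of_le (aestronglyMeasurable_gradient _)
      (Eventually.of_forall fun x => (hb2 n x).trans (le_abs_self _))
  let wn : ℕ → L2Grad d := fun n => WithLp.toLp 2 ((hm1 n).toLp _, (hm2 n).toLp _)
  have hw1 : ∀ n, (wn n).fst =ᵐ[volume] gn n := fun n => (hm1 n).coeFn_toLp
  have hw2 : ∀ n, (wn n).snd =ᵐ[volume] gradient (gn n) := fun n => (hm2 n).coeFn_toLp
  refine mem_H10_of_dominated (f := wn)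
    (fun n => mem_H10_of_lipschitz hU (hgn n) (hcs n) (hts n) (hw1 n) (hw2 n)) hF
    (fun n => (hw1 n).mono fun x hx => by rw [hx]; exact hb1 n x)
    (fun n => (hw2 n).mono fun x hx => by rw [hx]; exact hb2 n x) ?_ ?_
  · filter_upwards [ae_all_iff.mpr hw1, h1] with x hx hx'
    simp only [hx, hx']
    rw [tendsto_iff_dist_tendsto_zero]
    exact squeeze_zero (fun n => dist_nonneg) (fun n => abs_softThreshold_sub_le (hε n).le _) hε0
  · filter_upwards [ae_all_iff.mpr hw2, h2, hgr] with x hx hx' hg0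
    simp only [hx, hx']
    -- Where `g x = 0`, `gn n` vanishes near `x` and the hypothesis on the zero set identifies the
    -- limit. Elsewhere, as soon as `ε n < |g x|`, `gn n` differs from `g` by a constant near `x`.
    by_cases hgx : g x = 0
    · rw [hg0 hgx]
      refine tendsto_const_nhds.congr fun n => ?_
      have : gn n =ᶠ[𝓝 x] fun _ => (0 : ℝ) := by
        have h3 : ∀ᶠ y in 𝓝 x, |g y| < ε n :=
          hg.continuous.abs.continuousAt.eventually_lt_const (by simp [hgx, hε n])
        exact h3.mono fun y hy => softThreshold_eq_zero hy.le
      rw [gradient, this.fderiv_eq]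
      simp
    · refine tendsto_const_nhds.congr' ?_
      filter_upwards [hε0.eventually_lt_const (abs_pos.mpr hgx)] with n hn
      rcases lt_abs.mp hn with h | h
      · have : gn n =ᶠ[𝓝 x] fun y => g y - ε n :=
          (hg.continuous.continuousAt.eventually_const_lt h).mono
            fun y hy => softThreshold_of_lt (hε n).le hy
        rw [gradient, gradient, this.fderiv_eq, fderiv_sub_const]
      · have : gn n =ᶠ[𝓝 x] fun y => g y - (-ε n) :=
          (hg.continuous.continuousAt.eventually_lt_const (lt_neg_of_lt_neg h)).mono
            fun y hy => softThreshold_of_lt_neg (hε n).le hy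
        rw [gradient, gradient, this.fderiv_eq, fderiv_sub_const]

theorem ae_inner_add_ne_zero {a : Sp d} (ha : a ≠ 0) (c : ℝ) :
    ∀ᵐ x : Sp d, ⟪a, x⟫ + c ≠ 0 := by
  let H : AffineSubspace ℝ (Sp d) :=
    { carrier := {x | ⟪a, x⟫ + c = 0}
      smul_vsub_vadd_mem' := by
        intro r p q s hp hq hs
        simp only [mem_ofPred_eq, vsub_eq_sub, vadd_eq_add, inner_add_right, real_inner_smul_right,
          inner_sub_right] at hp hq hs ⊢
        linear_combination r * hp - r * hq + hs }
  have hH : H ≠ ⊤ := by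
    intro h
    have h1 : ∀ x, ⟪a, x⟫ + c = 0 := fun x => by
      have : x ∈ H := h ▸ AffineSubspace.mem_top ℝ _ x
      exact this
    have h2 := h1 0
    have h3 := h1 a
    rw [inner_zero_right] at h2
    have : ⟪a, a⟫ = 0 := by linarith
    exact ha (inner_self_eq_zero.mp this)
  have := Measure.addHaar_affineSubspace volume H hH
  rw [ae_iff]
  simp only [not_not]
  exact this

end

/-! ### Geometry of the mesh and nodal functions -/

section

namespace Mesh

variable {d : ℕ} {Ω : Set (Sp d)} (T : Mesh Ω)

variable {T} in
theorem mem_cells {K : Finset (Sp d)} : K ∈ T.cells ↔ K ∈ T.complex.faces ∧ K.card = d + 1 := by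
  simp [cells]

open Classical in
/-- The barycentric coordinates of the mesh element `K`. -/
def bary (K : Finset (Sp d)) : Sp d → Sp d →ᵃ[ℝ] ℝ :=
  if h : K ∈ T.cells then
    (exists_barycentric (T.complex.indep (mem_cells.mp h).1) (mem_cells.mp h).2).choose else 0

section bary

variable {T} {K K' : Finset (Sp d)}

theorem bary_spec (hK : K ∈ T.cells) : (∀ v ∉ K, T.bary K v = 0) ∧
      (∀ v ∈ K, T.bary K v v = 1) ∧ (∀ v, ∀ x ∈ K, x ≠ v → T.bary K v x = 0) ∧
      (∀ x, x ∈ convexHull ℝ (K : Set (Sp d)) ↔ ∀ v ∈ K, 0 ≤ T.bary K v x) ∧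
      (∀ x, x ∈ openSimplex K ↔ ∀ v ∈ K, 0 < T.bary K v x) ∧
      K.centroid ℝ id ∈ openSimplex K := by
  rw [bary, dif_pos hK]
  exact (exists_barycentric (T.complex.indep (mem_cells.mp hK).1) (mem_cells.mp hK).2).choose_spec

theorem bary_of_notMem (hK : K ∈ T.cells) {v : Sp d} (hv : v ∉ K) : T.bary K v = 0 :=
  (bary_spec hK).1 v hv

theorem bary_self (hK : K ∈ T.cells) {v : Sp d} (hv : v ∈ K) : T.bary K v v = 1 :=
  (bary_spec hK).2.1 v hv

theorem bary_of_ne (hK : K ∈ T.cells) {v x : Sp d} (hx : x ∈ K) (h : x ≠ v) :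
    T.bary K v x = 0 :=
  (bary_spec hK).2.2.1 v x hx h

theorem mem_convexHull_iff (hK : K ∈ T.cells) {x : Sp d} :
    x ∈ convexHull ℝ (K : Set (Sp d)) ↔ ∀ v ∈ K, 0 ≤ T.bary K v x :=
  (bary_spec hK).2.2.2.1 x

theorem mem_openSimplex_iff (hK : K ∈ T.cells) {x : Sp d} :
    x ∈ openSimplex K ↔ ∀ v ∈ K, 0 < T.bary K v x :=
  (bary_spec hK).2.2.2.2.1 x

theorem centroid_mem_openSimplex (hK : K ∈ T.cells) : K.centroid ℝ id ∈ openSimplex K :=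
  (bary_spec hK).2.2.2.2.2

theorem continuous_bary (K : Finset (Sp d)) (v : Sp d) : Continuous (T.bary K v) :=
  AffineMap.continuous_of_finiteDimensional _

theorem mem_convexHull_inter (hK : K ∈ T.cells) (hK' : K' ∈ T.cells) {x : Sp d}
    (hx : x ∈ convexHull ℝ (K : Set (Sp d))) (hx' : x ∈ convexHull ℝ (K' : Set (Sp d))) :
    x ∈ convexHull ℝ ((K : Set (Sp d)) ∩ K') := by
  rw [← T.complex.convexHull_inter_convexHull (mem_cells.mp hK).1 (mem_cells.mp hK').1]
  exact ⟨hx, hx'⟩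

/-- The barycentric coordinates of two mesh elements agree on their intersection. -/
theorem bary_congr (hK : K ∈ T.cells) (hK' : K' ∈ T.cells) {x : Sp d}
    (hx : x ∈ convexHull ℝ (K : Set (Sp d))) (hx' : x ∈ convexHull ℝ (K' : Set (Sp d))) (v : Sp d) :
    T.bary K v x = T.bary K' v x := by
  have h : EqOn (T.bary K v) (T.bary K' v) ((K : Set (Sp d)) ∩ K') := by
    rintro y ⟨hy, hy'⟩
    by_cases hyv : y = v
    · subst hyv
      rw [bary_self hK hy, bary_self hK' hy']
    · rw [bary_of_ne hK hy hyv, bary_of_ne hK' hy' hyv]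
  exact AffineMap.eqOn_affineSpan h
    (convexHull_subset_affineSpan _ (mem_convexHull_inter hK hK' hx hx'))

theorem mem_of_bary_pos (hK : K ∈ T.cells) (hK' : K' ∈ T.cells) {x v : Sp d}
    (hx : x ∈ convexHull ℝ (K : Set (Sp d))) (hx' : x ∈ convexHull ℝ (K' : Set (Sp d)))
    (h : 0 < T.bary K v x) : v ∈ K' := by
  by_contra hv
  rw [bary_congr hK hK' hx hx', bary_of_notMem hK' hv] at h
  exact lt_irrefl _ h

/-- At an interior point of `K` all barycentric coordinates are positive, so every vertex of `K` is
a vertex of `K'`; the cardinalities agree. -/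
theorem eq_of_mem_openSimplex (hK : K ∈ T.cells) (hK' : K' ∈ T.cells) {x : Sp d}
    (hx : x ∈ openSimplex K) (hx' : x ∈ convexHull ℝ (K' : Set (Sp d))) : K = K' := by
  refine Finset.eq_of_subset_of_card_le (fun v hv => ?_)
    ((mem_cells.mp hK').2.trans (mem_cells.mp hK).2.symm).le
  exact mem_of_bary_pos hK hK' (interior_subset hx) hx' ((mem_openSimplex_iff hK).mp hx v hv)

end bary

theorem exists_mem_convexHull {x : Sp d} (hx : x ∈ closure Ω) :
    ∃ K ∈ T.cells, x ∈ convexHull ℝ (K : Set (Sp d)) := by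
  rw [← T.space_eq, Geometry.SimplicialComplex.mem_space_iff] at hx
  obtain ⟨s, hs, hxs⟩ := hx
  obtain ⟨t, ht, hst, htc⟩ := T.pure_dim s hs
  exact ⟨t, mem_cells.mpr ⟨ht, htc⟩, convexHull_mono (by exact_mod_cast hst) hxs⟩

variable {T} in
theorem convexHull_subset_closure {K : Finset (Sp d)} (hK : K ∈ T.cells) :
    convexHull ℝ (K : Set (Sp d)) ⊆ closure Ω :=
  (Geometry.SimplicialComplex.convexHull_subset_space (mem_cells.mp hK).1).trans T.space_eq.subset

variable {T} in
theorem openSimplex_subset (hΩ : interior (closure Ω) = Ω) {K : Finset (Sp d)}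
    (hK : K ∈ T.cells) : openSimplex K ⊆ Ω :=
  (interior_mono (convexHull_subset_closure hK)).trans hΩ.subset

theorem mem_vertices_of_mem_cell {K : Finset (Sp d)} (hK : K ∈ T.cells) {v : Sp d} (hv : v ∈ K) :
    v ∈ T.complex.vertices := by
  rw [Geometry.SimplicialComplex.vertices_eq]
  exact mem_biUnion (mem_cells.mp hK).1 hv

theorem exists_cell_of_mem_vertices {v : Sp d} (hv : v ∈ T.complex.vertices) :
    ∃ K ∈ T.cells, v ∈ K := by
  obtain ⟨t, ht, hst, htc⟩ := T.pure_dim {v} hv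
  exact ⟨t, mem_cells.mpr ⟨ht, htc⟩, hst (Finset.mem_singleton_self v)⟩

theorem finite_vertices : T.complex.vertices.Finite := by
  rw [Geometry.SimplicialComplex.vertices_eq]
  exact T.finite_faces.biUnion fun s _ => s.finite_toSet

/-- The boundary of a convex set is Lebesgue-null, so the mesh skeleton can be ignored in integrals.
-/
theorem ae_mem_openSimplex :
    ∀ᵐ x, x ∈ closure Ω → ∃ K ∈ T.cells, x ∈ openSimplex K := by
  have h : ∀ K ∈ T.cells, ∀ᵐ x, x ∉ frontier (convexHull ℝ (K : Set (Sp d))) := fun K _ =>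
    measure_eq_zero_iff_ae_notMem.mp ((convex_convexHull ℝ _).addHaar_frontier volume)
  filter_upwards [(ae_ball_iff (Finset.countable_toSet T.cells)).mpr h] with x hx hxΩ
  obtain ⟨K, hK, hxK⟩ := T.exists_mem_convexHull hxΩ
  refine ⟨K, hK, by_contra fun h => hx K hK ⟨subset_closure hxK, h⟩⟩

/-- If a vertex `v` of the element `K` is in `Ω`, then so are all the points of `K` that are not on
the face opposite to `v`. -/
theorem mem_of_bary_pos_of_mem (hΩ : interior (closure Ω) = Ω) {K : Finset (Sp d)}
    (hK : K ∈ T.cells) {v : Sp d} (hv : v ∈ K) (hvΩ : v ∈ Ω) {y : Sp d}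
    (hy : y ∈ convexHull ℝ (K : Set (Sp d))) (hpos : 0 < T.bary K v y) : y ∈ Ω := by
  have hopen : IsOpen Ω := hΩ ▸ isOpen_interior
  let h : ℝ → Sp d → Sp d := fun t z => AffineMap.lineMap v z t
  have hcont : ∀ z, Continuous fun t => h t z := fun z => AffineMap.lineMap_continuous
  have hcont' : ∀ t, Continuous (h t) := fun t => by
    have : h t = fun z => t • (z - v) + v := by
      ext1 z; simp [h, AffineMap.lineMap_apply]
    rw [this]; fun_prop
  have hbary : ∀ (A : Sp d →ᵃ[ℝ] ℝ) t z, A (h t z) = A v + t * (A z - A v) := fun A t z => by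
    change A (AffineMap.lineMap v z t) = _
    rw [AffineMap.apply_lineMap, AffineMap.lineMap_apply, vsub_eq_sub, vadd_eq_add, smul_eq_mul]
    ring
  -- The map `h t` is the homothety of centre `v` and ratio `t`; a small ratio brings `y` into a
  -- neighbourhood of `v` contained in `Ω`.
  obtain ⟨t, ht0, ht1, htΩ⟩ : ∃ t : ℝ, 0 < t ∧ t < 1 ∧ h t y ∈ Ω := by
    have h1 : ∀ᶠ t in 𝓝[>] (0 : ℝ), h t y ∈ Ω := by
      refine Filter.Eventually.filter_mono nhdsWithin_le_nhds ?_
      refine (hcont y).continuousAt.eventually (hopen.mem_nhds ?_)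
      simpa [h] using hvΩ
    have h2 : ∀ᶠ t in 𝓝[>] (0 : ℝ), t ∈ Ioo (0 : ℝ) 1 := Ioo_mem_nhdsGT zero_lt_one
    obtain ⟨t, h3, h4⟩ := (h1.and h2).exists
    exact ⟨t, h4.1, h4.2, h3⟩
  have hyK : h t y ∈ convexHull ℝ (K : Set (Sp d)) :=
    (convex_convexHull ℝ _).lineMap_mem (subset_convexHull ℝ _ hv) hy ⟨ht0.le, ht1.le⟩
  have hposK : 0 < T.bary K v (h t y) := by
    rw [hbary, bary_self hK hv]
    nlinarith
  have hev1 : ∀ᶠ z in 𝓝 y, h t z ∈ Ω := (hcont' t).continuousAt.eventually (hopen.mem_nhds htΩ)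
  -- For `z` near `y`, the contracted point can only lie in elements that already contain `h t y`;
  -- all of these have `v` as a vertex.
  have hev2 : ∀ᶠ z in 𝓝 y, ∀ K' ∈ T.cells, h t z ∈ convexHull ℝ (K' : Set (Sp d)) →
      h t y ∈ convexHull ℝ (K' : Set (Sp d)) := by
    rw [Finset.eventually_all]
    intro K' _
    by_cases hc : h t y ∈ convexHull ℝ (K' : Set (Sp d))
    · exact Eventually.of_forall fun _ _ => hc
    · have : ∀ᶠ z in 𝓝 y, h t z ∉ convexHull ℝ (K' : Set (Sp d)) :=
        (hcont' t).continuousAt.eventually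
          ((isClosed_convexHull_finset K').isOpen_compl.mem_nhds hc)
      exact this.mono fun z hz hz' => absurd hz' hz
  have hK' : ∀ K' ∈ T.cells, h t y ∈ convexHull ℝ (K' : Set (Sp d)) →
      v ∈ K' ∧ 0 < T.bary K' v y := fun K' hK' hc => by
    have hvK' : v ∈ K' := mem_of_bary_pos hK hK' hyK hc hposK
    refine ⟨hvK', ?_⟩
    have h1 := bary_congr hK hK' hyK hc v
    rw [hbary, hbary, bary_self hK hv, bary_self hK' hvK'] at h1
    have h2 : T.bary K v y = T.bary K' v y := by
      have := mul_left_cancel₀ ht0.ne' (add_left_cancel h1)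
      linarith
    rwa [← h2]
  have hev3 : ∀ᶠ z in 𝓝 y, ∀ K' ∈ T.cells, h t y ∈ convexHull ℝ (K' : Set (Sp d)) →
      0 < T.bary K' v z := by
    rw [Finset.eventually_all]
    intro K' hKc
    by_cases hc : h t y ∈ convexHull ℝ (K' : Set (Sp d))
    · exact ((continuous_bary K' v).continuousAt.eventually_const_lt (hK' K' hKc hc).2).mono
        fun z hz _ => hz
    · exact Eventually.of_forall fun z hz => absurd hz hc
  -- It suffices that all `z` near `y` lie in the closure of `Ω`. The point `h t z` lies in some
  -- element `K'`; undoing the homothety divides the coordinates other than `v` by `t > 0`, so they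
  -- stay nonnegative, and the coordinate of `v` is positive at `z` by continuity. Hence `z ∈ K'`.
  rw [← hΩ, mem_interior_iff_mem_nhds]
  filter_upwards [hev1, hev2, hev3] with z h1 h2 h3
  obtain ⟨K', hKc, hz⟩ := T.exists_mem_convexHull (subset_closure h1)
  have hyK' := h2 K' hKc hz
  refine convexHull_subset_closure hKc ((mem_convexHull_iff hKc).mpr fun u hu => ?_)
  by_cases huv : u = v
  · rw [huv]
    exact (h3 K' hKc hyK').le
  · have h4 := (mem_convexHull_iff hKc).mp hz u hu
    rw [hbary, bary_of_ne hKc (hK' K' hKc hyK').1 (Ne.symm huv), zero_add, sub_zero] at h4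
    exact nonneg_of_mul_nonneg_right h4 ht0

/-- An affine function on `ℝ^d` in terms of its gradient. -/
theorem exists_inner_add_of_affineMap (A : Sp d →ᵃ[ℝ] ℝ) :
    ∃ (a : Sp d) (c : ℝ), ∀ x, A x = ⟪a, x⟫ + c := by
  refine ⟨(InnerProductSpace.toDual ℝ (Sp d)).symm A.linear.toContinuousLinearMap, A 0,
    fun x => ?_⟩
  rw [InnerProductSpace.toDual_symm_apply]
  have := A.linearMap_vsub x 0
  simp only [vsub_eq_sub, sub_zero] at this
  rw [LinearMap.coe_toContinuousLinearMap', this]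
  ring

open Classical in
/-- The nodal function of the vertex `v`. -/
def hat (v : Sp d) (y : Sp d) : ℝ :=
  if h : y ∈ Ω then T.bary (T.exists_mem_convexHull (subset_closure h)).choose v y else 0

variable {T} in
-- At a point of `K` outside `Ω`, the coordinate of `v` must vanish, since positivity would put the
-- point in `Ω` by `mem_of_bary_pos_of_mem`. This reconciles extension by zero with continuity.
theorem hat_eq_bary (hΩ : interior (closure Ω) = Ω) {v : Sp d} (hv : v ∈ Ω) {K : Finset (Sp d)}
    (hK : K ∈ T.cells) {y : Sp d} (hy : y ∈ convexHull ℝ (K : Set (Sp d))) :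
    T.hat v y = T.bary K v y := by
  by_cases h : y ∈ Ω
  · rw [hat, dif_pos h]
    have := (T.exists_mem_convexHull (subset_closure h)).choose_spec
    exact bary_congr this.1 hK this.2 hy v
  · rw [hat, dif_neg h]
    by_cases hvK : v ∈ K
    · have h1 := (mem_convexHull_iff hK).mp hy v hvK
      refine h1.antisymm (not_lt.mp fun h2 => h ?_)
      exact T.mem_of_bary_pos_of_mem hΩ hK hvK hv hy h2
    · rw [bary_of_notMem hK hvK]; rfl

/-- The pieces of a finite closed cover of `ℝ^d`: the mesh elements and the complement of `Ω`. -/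
def piece : Option T.cells → Set (Sp d)
  | none => Ωᶜ
  | some K => convexHull ℝ ((K : Finset (Sp d)) : Set (Sp d))

theorem isClosed_piece (hΩ : interior (closure Ω) = Ω) : ∀ i, IsClosed (T.piece i)
  | none => (hΩ ▸ isOpen_interior : IsOpen Ω).isClosed_compl
  | some K => isClosed_convexHull_finset K.1

theorem exists_mem_piece (x : Sp d) : ∃ i, x ∈ T.piece i := by
  by_cases hx : x ∈ Ω
  · obtain ⟨K, hK, hxK⟩ := T.exists_mem_convexHull (subset_closure hx)
    exact ⟨some ⟨K, hK⟩, hxK⟩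
  · exact ⟨none, hx⟩

theorem continuous_hat (hΩ : interior (closure Ω) = Ω) {v : Sp d} (hv : v ∈ Ω) :
    Continuous (T.hat v) := by
  refine (locallyFinite_of_finite T.piece).continuous
    (iUnion_eq_univ_iff.mpr T.exists_mem_piece) (T.isClosed_piece hΩ) ?_
  rintro (_ | K)
  · refine continuousOn_const.congr (f := fun _ => 0) fun x hx => ?_
    exact dif_neg hx
  · exact (continuous_bary K.1 v).continuousOn.congr fun x hx => hat_eq_bary hΩ hv K.2 hx

theorem hat_mem_VH (hΩ : interior (closure Ω) = Ω) {v : Sp d} (hv : v ∈ Ω) : T.hat v ∈ T.VH := by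
  refine ⟨T.continuous_hat hΩ hv, fun x hx => dif_neg hx, fun K hK => ?_⟩
  obtain ⟨a, c, h⟩ := exists_inner_add_of_affineMap (T.bary K v)
  exact ⟨a, c, fun x hx => (hat_eq_bary hΩ hv hK hx).trans (h x)⟩

theorem hat_self (hΩ : interior (closure Ω) = Ω) {v : Sp d} (hv : v ∈ T.complex.vertices ∩ Ω) :
    T.hat v v = 1 := by
  obtain ⟨K, hK, hvK⟩ := T.exists_cell_of_mem_vertices hv.1
  rw [hat_eq_bary hΩ hv.2 hK (subset_convexHull ℝ _ hvK), bary_self hK hvK]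

theorem hat_of_ne (hΩ : interior (closure Ω) = Ω) {v y : Sp d} (hv : v ∈ Ω)
    (hy : y ∈ T.complex.vertices) (h : y ≠ v) : T.hat v y = 0 := by
  obtain ⟨K, hK, hyK⟩ := T.exists_cell_of_mem_vertices hy
  rw [hat_eq_bary hΩ hv hK (subset_convexHull ℝ _ hyK), bary_of_ne hK hyK h]

/-- Vertices outside `Ω` carry the value zero by definition of `V_H`, and an affine function that
vanishes at the vertices of a simplex vanishes on it. -/
theorem VH_eq_zero_of_vertices {v : T.VH}
    (h : ∀ y ∈ T.complex.vertices ∩ Ω, (v : Sp d → ℝ) y = 0) : v = 0 := by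
  ext x
  by_cases hx : x ∈ Ω
  · obtain ⟨K, hK, hxK⟩ := T.exists_mem_convexHull (subset_closure hx)
    obtain ⟨a, c, hac⟩ := v.2.2.2 K hK
    have hsub : convexHull ℝ (K : Set (Sp d)) ⊆ {x | ⟪a, x⟫ = -c} := by
      refine convexHull_min (fun y hy => ?_) ?_
      · have h0 : (v : Sp d → ℝ) y = 0 := by
          by_cases hyΩ : y ∈ Ω
          · exact h y ⟨T.mem_vertices_of_mem_cell hK hy, hyΩ⟩
          · exact v.2.2.1 y hyΩ
        have := hac y (subset_convexHull ℝ _ hy)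
        rw [h0] at this
        rw [mem_ofPred_eq]
        linarith
      · exact convex_hyperplane (innerSL ℝ a).toLinearMap.isLinear (-c)
    have h1 : ⟪a, x⟫ = -c := hsub hxK
    rw [hac x hxK, h1]
    simp
  · exact v.2.2.1 x hx

theorem existsUnique_nodal (hΩ : interior (closure Ω) = Ω) {x : Sp d}
    (hx : x ∈ T.complex.vertices ∩ Ω) : ∃! φ : T.VH, (φ : Sp d → ℝ) x = 1 ∧
      ∀ y ∈ T.complex.vertices ∩ Ω, y ≠ x → (φ : Sp d → ℝ) y = 0 := by
  refine ⟨⟨T.hat x, T.hat_mem_VH hΩ hx.2⟩, ⟨T.hat_self hΩ hx, fun y hy h =>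
    T.hat_of_ne hΩ hx.2 hy.1 h⟩, ?_⟩
  rintro φ ⟨h1, h2⟩
  rw [← sub_eq_zero]
  refine T.VH_eq_zero_of_vertices fun y hy => ?_
  change (φ : Sp d → ℝ) y - T.hat x y = 0
  by_cases hyx : y = x
  · rw [hyx, h1, T.hat_self hΩ hx, sub_self]
  · rw [h2 y hy hyx, T.hat_of_ne hΩ hx.2 hy.1 hyx, sub_self]

/-- The nodal functions span `V_H`. -/
theorem span_nodal (hΩ : interior (closure Ω) = Ω) :
    Submodule.span ℝ {φ : T.VH | T.IsNodal φ} = ⊤ := by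
  rw [eq_top_iff]
  rintro v -
  have hfin : (T.complex.vertices ∩ Ω).Finite := T.finite_vertices.inter_of_left Ω
  have : Fintype ↥(T.complex.vertices ∩ Ω) := hfin.fintype
  let φ : ↥(T.complex.vertices ∩ Ω) → T.VH := fun x => ⟨T.hat x, T.hat_mem_VH hΩ x.2.2⟩
  have hv : v = ∑ x : ↥(T.complex.vertices ∩ Ω), (v : Sp d → ℝ) x • φ x := by
    rw [← sub_eq_zero]
    refine T.VH_eq_zero_of_vertices fun y hy => ?_
    rw [Submodule.coe_sub, Pi.sub_apply, Submodule.coe_sum, Finset.sum_apply,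
      Finset.sum_eq_single ⟨y, hy⟩]
    · change (v : Sp d → ℝ) y - (v : Sp d → ℝ) y * T.hat y y = 0
      rw [T.hat_self hΩ hy, mul_one, sub_self]
    · intro x _ hx
      change (v : Sp d → ℝ) x * T.hat x y = 0
      rw [T.hat_of_ne hΩ x.2.2 hy.1 fun h => hx (Subtype.ext h.symm), mul_zero]
    · intro h
      exact absurd (Finset.mem_univ _) h
  rw [hv]
  refine Submodule.sum_mem _ fun x _ => Submodule.smul_mem _ _ (Submodule.subset_span ?_)
  exact ⟨x, x.2, T.hat_self hΩ x.2, fun y hy h => T.hat_of_ne hΩ x.2.2 hy.1 h⟩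

end Mesh

end

/-! ### Piecewise constant gradients and the embedding of `V_H` into `H¹₀(Ω)` -/

section

theorem single_le_sum_nnreal {ι : Type*} (s : Finset ι) (F : ι → NNReal) {i : ι} (hi : i ∈ s) :
    F i ≤ ∑ j ∈ s, F j :=
  Finset.single_le_sum (f := F) (fun j _ => zero_le (a := F j)) hi

namespace Mesh

variable {d : ℕ} {Ω : Set (Sp d)} (T : Mesh Ω)

section cellGrad

variable {T} {K : Finset (Sp d)}

theorem hasGradientAt_inner_add (a : Sp d) (c : ℝ) (x : Sp d) :
    HasGradientAt (fun y : Sp d => ⟪a, y⟫ + c) a x := by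
  rw [hasGradientAt_iff_hasFDerivAt]
  have h : HasFDerivAt (fun y : Sp d => ⟪a, y⟫) (InnerProductSpace.toDual ℝ (Sp d) a) x :=
    (InnerProductSpace.toDual ℝ (Sp d) a).hasFDerivAt
  exact h.add_const c

theorem exists_hasGradientAt (v : T.VH) (hK : K ∈ T.cells) :
    ∃ (a : Sp d) (c : ℝ), (∀ x ∈ convexHull ℝ (K : Set (Sp d)), (v : Sp d → ℝ) x = ⟪a, x⟫ + c) ∧
      ∀ x ∈ openSimplex K, HasGradientAt (v : Sp d → ℝ) a x := by
  obtain ⟨a, c, h⟩ := v.2.2.2 K hK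
  refine ⟨a, c, h, fun x hx => ?_⟩
  refine (hasGradientAt_inner_add a c x).congr_of_eventuallyEq ?_
  filter_upwards [(isOpen_openSimplex K).mem_nhds hx] with y hy
  exact h y (interior_subset hy)

theorem hasGradientAt_cellGrad (v : T.VH) (hK : K ∈ T.cells) {x : Sp d} (hx : x ∈ openSimplex K) :
    HasGradientAt (v : Sp d → ℝ) (cellGrad v K) x := by
  obtain ⟨a, c, -, h⟩ := exists_hasGradientAt v hK
  rw [cellGrad, (h _ (centroid_mem_openSimplex hK)).gradient]
  exact h x hx

theorem gradient_eq_cellGrad (v : T.VH) (hK : K ∈ T.cells) {x : Sp d} (hx : x ∈ openSimplex K) :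
    gradient (v : Sp d → ℝ) x = cellGrad v K :=
  (hasGradientAt_cellGrad v hK hx).gradient

theorem exists_eq_inner_cellGrad_add (v : T.VH) (hK : K ∈ T.cells) :
    ∃ c : ℝ, ∀ x ∈ convexHull ℝ (K : Set (Sp d)), (v : Sp d → ℝ) x = ⟪cellGrad v K, x⟫ + c := by
  obtain ⟨a, c, h1, h⟩ := exists_hasGradientAt v hK
  rw [cellGrad, (h _ (centroid_mem_openSimplex hK)).gradient]
  exact ⟨c, h1⟩

theorem cellGrad_add (u v : T.VH) (hK : K ∈ T.cells) :
    cellGrad ((u + v : T.VH) : Sp d → ℝ) K = cellGrad u K + cellGrad v K := by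
  have h1 := (hasGradientAt_cellGrad u hK (centroid_mem_openSimplex hK)).hasFDerivAt
  have h2 := (hasGradientAt_cellGrad v hK (centroid_mem_openSimplex hK)).hasFDerivAt
  have h3 := h1.add h2
  rw [← map_add] at h3
  exact (hasGradientAt_iff_hasFDerivAt.mpr h3).gradient

theorem cellGrad_smul (r : ℝ) (v : T.VH) (hK : K ∈ T.cells) :
    cellGrad ((r • v : T.VH) : Sp d → ℝ) K = r • cellGrad v K := by
  have h1 := (hasGradientAt_cellGrad v hK (centroid_mem_openSimplex hK)).hasFDerivAt
  have h3 := h1.const_smul r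
  have h4 : r • (InnerProductSpace.toDual ℝ (Sp d)) (cellGrad v K) =
      InnerProductSpace.toDual ℝ (Sp d) (r • cellGrad v K) := by
    simp
  rw [h4] at h3
  exact (hasGradientAt_iff_hasFDerivAt.mpr h3).gradient

end cellGrad

theorem toL2Grad_fst (v : T.VH) : (T.toL2Grad v).fst =ᵐ[volume] (v : Sp d → ℝ) :=
  (T.memLp_of_mem_VH v).coeFn_toLp

theorem toL2Grad_snd_ae (v : T.VH) : ∀ᵐ x, (T.toL2Grad v).snd x =
    ∑ K ∈ T.cells, (openSimplex K).indicator (fun _ => cellGrad v K) x := by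
  have h : ∀ K ∈ T.cells, ∀ᵐ x, indicatorConstLp 2 (measurableSet_openSimplex K)
      (volume_openSimplex_ne_top K) (cellGrad v K) x =
      (openSimplex K).indicator (fun _ => cellGrad v K) x := fun K _ => indicatorConstLp_coeFn
  filter_upwards [coeFn_finset_sum T.cells fun K => indicatorConstLp 2
    (measurableSet_openSimplex K) (volume_openSimplex_ne_top K) (cellGrad v K),
    (ae_ball_iff (Finset.countable_toSet T.cells)).mpr h] with x h1 h2
  exact h1.trans (Finset.sum_congr rfl fun K hK => h2 K hK)

theorem toL2Grad_snd_of_mem (v : T.VH) {K : Finset (Sp d)} (hK : K ∈ T.cells) :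
    ∀ᵐ x, x ∈ openSimplex K → (T.toL2Grad v).snd x = cellGrad v K := by
  filter_upwards [T.toL2Grad_snd_ae v] with x hx hxK
  rw [hx, Finset.sum_eq_single K, indicator_of_mem hxK]
  · intro K' hK' hne
    refine indicator_of_notMem (fun h => hne ?_) _
    exact (eq_of_mem_openSimplex hK hK' hxK (interior_subset h)).symm
  · exact fun h => absurd hK h

theorem toL2Grad_snd (v : T.VH) :
    (T.toL2Grad v).snd =ᵐ[volume] gradient (v : Sp d → ℝ) := by
  have h : ∀ K ∈ T.cells, ∀ᵐ x, x ∈ openSimplex K → (T.toL2Grad v).snd x = cellGrad v K :=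
    fun K hK => T.toL2Grad_snd_of_mem v hK
  filter_upwards [T.toL2Grad_snd_ae v, T.ae_mem_openSimplex,
    (ae_ball_iff (Finset.countable_toSet T.cells)).mpr h] with x h1 h2 h3
  by_cases hx : x ∈ closure Ω
  · obtain ⟨K, hK, hxK⟩ := h2 hx
    rw [h3 K hK hxK, gradient_eq_cellGrad v hK hxK]
  · have h0 : (v : Sp d → ℝ) =ᶠ[𝓝 x] fun _ => (0 : ℝ) := by
      filter_upwards [isClosed_closure.isOpen_compl.mem_nhds hx] with y hy
      exact v.2.2.1 y fun h => hy (subset_closure h)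
    rw [h1, gradient, h0.fderiv_eq, Finset.sum_eq_zero]
    · simp
    · intro K hK
      exact indicator_of_notMem
        (fun h => hx (convexHull_subset_closure hK (interior_subset h))) _

theorem exists_lipschitzWith (hΩ : interior (closure Ω) = Ω) (v : T.VH) :
    ∃ C : NNReal, LipschitzWith C (v : Sp d → ℝ) := by
  obtain ⟨F, hF⟩ : ∃ F : Finset (Sp d) → NNReal, ∀ K, F K = ‖cellGrad (v : Sp d → ℝ) K‖₊ :=
    ⟨_, fun _ => rfl⟩
  -- The sum is a crude bound for the largest cell gradient; it serves as the common constant for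
  -- all pieces, including `Ωᶜ`.
  refine ⟨∑ K ∈ T.cells, F K, lipschitzWith_of_finite_closed_cover
    (T.isClosed_piece hΩ) T.exists_mem_piece v.2.1 ?_⟩
  rintro (_ | ⟨K, hK⟩)
  · refine LipschitzOnWith.of_dist_le_mul fun x hx y hy => ?_
    rw [v.2.2.1 x hx, v.2.2.1 y hy, dist_self]
    positivity
  · obtain ⟨c, hc⟩ := exists_eq_inner_cellGrad_add v hK
    have hle : ‖cellGrad (v : Sp d → ℝ) K‖ ≤ ((∑ K ∈ T.cells, F K : NNReal) : ℝ) := by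
      rw [← coe_nnnorm, ← hF]
      exact NNReal.coe_le_coe.mpr (single_le_sum_nnreal T.cells F hK)
    refine LipschitzOnWith.of_dist_le_mul fun x hx y hy => ?_
    rw [hc x hx, hc y hy, dist_add_right, Real.dist_eq, ← inner_sub_right, dist_eq_norm]
    exact (abs_real_inner_le_norm _ _).trans (mul_le_mul_of_nonneg_right hle (norm_nonneg _))

/-- The criterion `mem_H10_of_lipschitz_of_eq_zero` applies: on each element, either the gradient of
`v` is zero or the zero set of `v` lies in a hyperplane, which is null. -/
theorem toL2Grad_mem_H10 (hΩ : interior (closure Ω) = Ω) (v : T.VH) : T.toL2Grad v ∈ H10 Ω := by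
  obtain ⟨C, hC⟩ := T.exists_lipschitzWith hΩ v
  refine mem_H10_of_lipschitz_of_eq_zero (hΩ ▸ isOpen_interior) T.isCompact_closure hC v.2.2.1 ?_
    (T.toL2Grad_fst v) (T.toL2Grad_snd v)
  have h : ∀ K ∈ T.cells, ∀ᵐ x, x ∈ openSimplex K → (v : Sp d → ℝ) x = 0 →
      gradient (v : Sp d → ℝ) x = 0 := fun K hK => by
    obtain ⟨c, hc⟩ := exists_eq_inner_cellGrad_add v hK
    by_cases ha : cellGrad v K = 0
    · exact Eventually.of_forall fun x hx _ => (gradient_eq_cellGrad v hK hx).trans ha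
    · filter_upwards [ae_inner_add_ne_zero ha c] with x hx hxK h0
      exact absurd ((hc x (interior_subset hxK)).symm.trans h0) hx
  filter_upwards [T.ae_mem_openSimplex,
    (ae_ball_iff (Finset.countable_toSet T.cells)).mpr h] with x h2 h3 h0
  by_cases hx : x ∈ closure Ω
  · obtain ⟨K, hK, hxK⟩ := h2 hx
    exact h3 K hK hxK h0
  · have h0 : (v : Sp d → ℝ) =ᶠ[𝓝 x] fun _ => (0 : ℝ) := by
      filter_upwards [isClosed_closure.isOpen_compl.mem_nhds hx] with y hy
      exact v.2.2.1 y fun h => hy (subset_closure h)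
    rw [gradient, h0.fderiv_eq]
    simp

/-- `v ↦ (v, ∇v)` as a linear map on `V_H`. -/
def toL2GradL : T.VH →ₗ[ℝ] L2Grad d where
  toFun := T.toL2Grad
  map_add' u v := by
    refine WithLp.ofLp_injective 2 (Prod.ext rfl (Lp.ext ?_))
    filter_upwards [T.toL2Grad_snd_ae u, T.toL2Grad_snd_ae v, T.toL2Grad_snd_ae (u + v),
      Lp.coeFn_add (T.toL2Grad u).snd (T.toL2Grad v).snd] with x h1 h2 h3 h4
    refine h3.trans (Eq.trans ?_ h4.symm)
    rw [Pi.add_apply, h1, h2, ← Finset.sum_add_distrib]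
    refine Finset.sum_congr rfl fun K hK => ?_
    rw [cellGrad_add u v hK]
    by_cases hx : x ∈ openSimplex K <;> simp [hx]
  map_smul' r v := by
    refine WithLp.ofLp_injective 2 (Prod.ext rfl (Lp.ext ?_))
    filter_upwards [T.toL2Grad_snd_ae v, T.toL2Grad_snd_ae (r • v),
      Lp.coeFn_smul r (T.toL2Grad v).snd] with x h1 h2 h3
    refine h2.trans (Eq.trans ?_ h3.symm)
    rw [Pi.smul_apply, h1, Finset.smul_sum]
    refine Finset.sum_congr rfl fun K hK => ?_
    rw [cellGrad_smul r v hK]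
    by_cases hx : x ∈ openSimplex K <;> simp [hx]

@[simp]
theorem toL2GradL_apply (v : T.VH) : T.toL2GradL v = T.toL2Grad v := rfl

theorem VH_eq_zero_of_toL2Grad_eq_zero {v : T.VH} (h : T.toL2Grad v = 0) : v = 0 := by
  have h1 := T.toL2Grad_fst v
  have h2 : (v : Sp d → ℝ) =ᵐ[volume] fun _ => (0 : ℝ) := by
    rw [h] at h1
    exact h1.symm.trans (Lp.coeFn_zero ℝ 2 (volume : Measure (Sp d)))
  exact Subtype.ext ((v.2.1.ae_eq_iff_eq volume continuous_const).mp h2)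

instance finiteDimensional_VH : FiniteDimensional ℝ T.VH := by
  have hfin : (T.complex.vertices ∩ Ω).Finite := T.finite_vertices.inter_of_left Ω
  have : Fintype ↥(T.complex.vertices ∩ Ω) := hfin.fintype
  let e : T.VH →ₗ[ℝ] (↥(T.complex.vertices ∩ Ω) → ℝ) :=
    { toFun := fun v x => (v : Sp d → ℝ) x
      map_add' := fun u v => rfl
      map_smul' := fun r v => rfl }
  refine FiniteDimensional.of_injective e ((injective_iff_map_eq_zero e).mpr fun v hv => ?_)
  exact T.VH_eq_zero_of_vertices fun y hy => congrFun hv ⟨y, hy⟩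

end Mesh

end

/-! ### Local problems: correctors are multiples of the bubble -/

section

variable {d : ℕ}

/-- The elements of `L2Grad` that vanish on `U`. -/
def vanishingOn (U : Set (Sp d)) : Submodule ℝ (L2Grad d) :=
  ((LpToLpRestrictCLM (Sp d) ℝ ℝ volume 2 U).toLinearMap.comp
      (WithLp.fstₗ 2 ℝ (Lp ℝ 2 (volume : Measure (Sp d))) _)).ker ⊓
    ((LpToLpRestrictCLM (Sp d) (Sp d) ℝ volume 2 U).toLinearMap.comp
      (WithLp.sndₗ 2 ℝ _ (Lp (Sp d) 2 (volume : Measure (Sp d))))).ker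

theorem mem_vanishingOn {U : Set (Sp d)} {z : L2Grad d} : z ∈ vanishingOn U ↔
    (∀ᵐ x ∂(volume.restrict U), z.fst x = 0) ∧ ∀ᵐ x ∂(volume.restrict U), z.snd x = 0 := by
  rw [← Lp_restrict_eq_zero_iff, ← Lp_restrict_eq_zero_iff]
  rfl

theorem H10_le_vanishingOn {U V : Set (Sp d)} (hU : MeasurableSet U) (hV : MeasurableSet V)
    (h : Disjoint U V) : H10 U ≤ vanishingOn V := fun z hz => by
  rw [mem_vanishingOn, ae_restrict_iff' hV, ae_restrict_iff' hV]
  exact ⟨(fst_ae_eq_zero_of_mem_H10 hU hz).mono fun x hx hxV => hx (h.notMem_of_mem_right hxV),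
    (snd_ae_eq_zero_of_mem_H10 hU hz).mono fun x hx hxV => hx (h.notMem_of_mem_right hxV)⟩

theorem globalForm_eq_zero_of_vanishingOn {U : Set (Sp d)} (hU : MeasurableSet U) (m : ℝ) (b : Sp d)
    {u v : L2Grad d} (hu : u ∈ vanishingOn U) (hv : v ∈ H10 U) : globalForm m b u v = 0 := by
  rw [← aForm_eq_globalForm_of_right hU m b u hv, aForm, advForm]
  refine integral_eq_zero_of_ae ?_
  filter_upwards [(mem_vanishingOn.mp hu).2] with x hx
  simp [hx]

/-- Turns boundary equality into membership in linear subspaces, so that it can be subtracted and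
combined. -/
theorem eqOnBoundary_iff {U : Set (Sp d)} {u v : L2Grad d} :
    EqOnBoundary U u v ↔ ∃ z ∈ H10 U, z - (u - v) ∈ vanishingOn U := by
  refine exists_congr fun z => and_congr_right fun _ => ?_
  rw [mem_vanishingOn]
  have h1 : ∀ᵐ x ∂(volume.restrict U),
      (z - (u - v)).fst x = z.fst x - (u.fst x - v.fst x) := by
    refine ae_restrict_of_ae ?_
    filter_upwards [Lp.coeFn_sub z.fst (u.fst - v.fst), Lp.coeFn_sub u.fst v.fst] with x h1 h2
    rw [WithLp.sub_fst, WithLp.sub_fst, h1, Pi.sub_apply, h2, Pi.sub_apply]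
  have h2 : ∀ᵐ x ∂(volume.restrict U),
      (z - (u - v)).snd x = z.snd x - (u.snd x - v.snd x) := by
    refine ae_restrict_of_ae ?_
    filter_upwards [Lp.coeFn_sub z.snd (u.snd - v.snd), Lp.coeFn_sub u.snd v.snd] with x h1 h2
    rw [WithLp.sub_snd, WithLp.sub_snd, h1, Pi.sub_apply, h2, Pi.sub_apply]
  refine and_congr (eventually_congr ?_) (eventually_congr ?_)
  · filter_upwards [h1] with x hx
    rw [hx, sub_eq_zero]
  · filter_upwards [h2] with x hx
    rw [hx, sub_eq_zero]

/-- The functional `z ↦ ∫_K z`. -/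
def cellIntegral (K : Finset (Sp d)) : L2Grad d →L[ℝ] ℝ :=
  (innerSL ℝ (indicatorConstLp 2 (measurableSet_openSimplex K)
    (volume_openSimplex_ne_top K) (1 : ℝ))).comp
    (WithLp.fstL 2 ℝ _ (Lp (Sp d) 2 (volume : Measure (Sp d))))

theorem cellIntegral_apply (K : Finset (Sp d)) (z : L2Grad d) :
    cellIntegral K z = ∫ x in openSimplex K, z.fst x :=
  L2.inner_indicatorConstLp_one (measurableSet_openSimplex K) (volume_openSimplex_ne_top K) z.fst

theorem cellIntegral_eq_zero {K : Finset (Sp d)} {z : L2Grad d}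
    (hz : z ∈ vanishingOn (openSimplex K)) : cellIntegral K z = 0 := by
  rw [cellIntegral_apply]
  exact integral_eq_zero_of_ae (mem_vanishingOn.mp hz).1

/-- `u ∈ H¹₀(K)` solves `-m Δ u + b · ∇u = s` in `K`. -/
def SolvesCell (m : ℝ) (b : Sp d) (K : Finset (Sp d)) (s : ℝ) (u : L2Grad d) : Prop :=
  u ∈ H10 (openSimplex K) ∧
    ∀ v ∈ H10 (openSimplex K), globalForm m b u v = (s • cellIntegral K) v

instance completeSpace_H10 (U : Set (Sp d)) : CompleteSpace (H10 U) :=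
  (isClosed_H10 U).completeSpace_coe

theorem existsUnique_solvesCell (hd : 1 ≤ d) {m : ℝ} (hm : 0 < m) (b : Sp d) (K : Finset (Sp d))
    (s : ℝ) : ∃! u, SolvesCell m b K s u :=
  existsUnique_variational hd (isBounded_openSimplex K) hm b le_rfl _

theorem isBubble_iff {m : ℝ} {b : Sp d} {K : Finset (Sp d)} {u : L2Grad d} :
    IsBubble m b K u ↔ SolvesCell m b K 1 u := by
  refine and_congr_right fun _ => forall₂_congr fun v hv => ?_
  rw [aForm_eq_globalForm_of_right (measurableSet_openSimplex K) m b u hv, one_smul,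
    cellIntegral_apply]

theorem gradient_coord (α : Fin d) (x : Sp d) :
    gradient (fun y : Sp d => y α) x = EuclideanSpace.single α 1 := by
  have : (fun y : Sp d => y α) = fun y => ⟪EuclideanSpace.single α (1 : ℝ), y⟫ + 0 := by
    ext y
    rw [EuclideanSpace.inner_single_left]
    simp
  rw [this]
  exact (Mesh.hasGradientAt_inner_add _ 0 x).gradient

/-- The diffusion term is a multiple of the mean gradient of `v`, which is zero. A function with
constant gradient `c` is thus seen by local test functions only through the scalar `⟪b, c⟫`. -/
theorem setIntegral_const_gradient {K : Finset (Sp d)} (m : ℝ) (b c : Sp d) {v : L2Grad d}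
    (hv : v ∈ H10 (openSimplex K)) :
    ∫ x in openSimplex K, (m * ⟪c, v.snd x⟫ + v.fst x * ⟪b, c⟫) = ⟪b, c⟫ * cellIntegral K v := by
  have hf : Integrable v.fst (volume.restrict (openSimplex K)) :=
    integrableOn_Lp_of_measure_ne_top v.fst fact_one_le_two_ennreal.elim
      (volume_openSimplex_ne_top K)
  have hs : Integrable v.snd (volume.restrict (openSimplex K)) :=
    integrableOn_Lp_of_measure_ne_top v.snd fact_one_le_two_ennreal.elim
      (volume_openSimplex_ne_top K)
  rw [integral_add ((hs.const_inner c).const_mul m) (hf.mul_const _), integral_const_mul,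
    setIntegral_inner_snd_eq_zero (measurableSet_openSimplex K) (volume_openSimplex_ne_top K) c hv,
    integral_mul_const, cellIntegral_apply]
  ring

theorem isCorrector_iff {m : ℝ} {b : Sp d} {K : Finset (Sp d)} {α : Fin d} {u : L2Grad d} :
    IsCorrector m b K α u ↔ SolvesCell m b K (-b α) u := by
  refine and_congr_right fun _ => forall₂_congr fun v hv => ?_
  rw [aForm_eq_globalForm_of_right (measurableSet_openSimplex K) m b u hv, advForm]
  simp only [gradient_coord]
  rw [setIntegral_const_gradient m b _ hv, EuclideanSpace.inner_single_right]
  simp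

theorem SolvesCell.smul {m : ℝ} {b : Sp d} {K : Finset (Sp d)} {s : ℝ} {u : L2Grad d}
    (h : SolvesCell m b K s u) (r : ℝ) : SolvesCell m b K (r * s) (r • u) := by
  refine ⟨Submodule.smul_mem _ r h.1, fun v hv => ?_⟩
  rw [← globalBilin_apply, map_smul, LinearMap.smul_apply, globalBilin_apply, h.2 v hv]
  simp [mul_assoc]

/-- Both sides solve the same local problem with constant source `-b α`. -/
theorem IsCorrector.eq_smul (hd : 1 ≤ d) {m : ℝ} (hm : 0 < m) {b : Sp d} {K : Finset (Sp d)}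
    {α : Fin d} {χ B : L2Grad d} (hχ : IsCorrector m b K α χ) (hB : IsBubble m b K B) :
    χ = (-b α) • B := by
  refine (existsUnique_solvesCell hd hm b K (-b α)).unique (isCorrector_iff.mp hχ) ?_
  simpa using (isBubble_iff.mp hB).smul (-b α)

/-- The integral of the bubble function is positive on a nonempty element. -/
theorem cellIntegral_bubble_pos (hd : 1 ≤ d) {m : ℝ} (hm : 0 < m) {b : Sp d} {K : Finset (Sp d)}
    {B : L2Grad d} (hB : IsBubble m b K B) (hK : (openSimplex K).Nonempty) :
    0 < cellIntegral K B := by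
  have hB' := isBubble_iff.mp hB
  have h1 := hB'.2 B hB'.1
  rw [one_smul] at h1
  have h2 := globalForm_self m b hB'.1
  have h3 : 0 ≤ cellIntegral K B := by
    rw [← h1, h2]; positivity
  refine h3.lt_of_ne fun h0 => ?_
  -- A zero integral would make the energy of `B`, hence `B` itself, vanish; the bubble equation
  -- would then give integral zero to a bump function supported in `K`.
  have hB0 : B = 0 := eq_zero_of_globalForm_self_eq_zero hd (isBounded_openSimplex K) hm b hB'.1
    (h1.trans h0.symm)
  obtain ⟨p, hp⟩ := hK
  obtain ⟨ε, hε, hball⟩ := Metric.isOpen_iff.mp (isOpen_openSimplex K) p hp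
  let φ : ContDiffBump p := ⟨ε / 4, ε / 2, by positivity, by linarith⟩
  have hsupp : tsupport φ ⊆ openSimplex K := by
    rw [φ.tsupport_eq]
    exact (Metric.closedBall_subset_ball (half_lt_self hε)).trans hball
  obtain ⟨w, hw, hw1, -⟩ := exists_mem_testGraph (U := openSimplex K) φ.contDiff
    φ.hasCompactSupport hsupp
  have h4 := hB'.2 w (testGraph_subset_H10 _ hw)
  rw [hB0, ← globalBilin_apply, LinearMap.map_zero₂, one_smul, cellIntegral_apply,
    integral_congr_ae (ae_restrict_of_ae hw1),
    setIntegral_eq_integral_of_forall_compl_eq_zero] at h4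
  · exact absurd h4 φ.integral_pos.ne
  · intro x hx
    exact image_eq_zero_of_notMem_tsupport fun h => hx (hsupp h)

end

/-! ### Assembling over the mesh: loads, and pairing of `V_H` with local functions -/

section

namespace Mesh

variable {d : ℕ} {Ω : Set (Sp d)} (T : Mesh Ω)

variable {T} in
theorem disjoint_openSimplex {K K' : Finset (Sp d)} (hK : K ∈ T.cells) (hK' : K' ∈ T.cells)
    (h : K ≠ K') : Disjoint (openSimplex K) (openSimplex K') :=
  Set.disjoint_left.mpr fun _ hx hx' => h (eq_of_mem_openSimplex hK hK' hx (interior_subset hx'))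

variable {T} in
theorem H10_cell_le_vanishingOn {K K' : T.cells} (h : K ≠ K') :
    H10 (openSimplex K.1) ≤ vanishingOn (openSimplex K'.1) :=
  H10_le_vanishingOn (measurableSet_openSimplex _) (measurableSet_openSimplex _)
    (disjoint_openSimplex K.2 K'.2 fun h' => h (Subtype.ext h'))

theorem measurableSet_domain (hΩ : interior (closure Ω) = Ω) : MeasurableSet Ω :=
  (hΩ ▸ isOpen_interior : IsOpen Ω).measurableSet

theorem isBounded_domain (T : Mesh Ω) : Bornology.IsBounded Ω :=
  T.isCompact_closure.isBounded.subset subset_closure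

theorem domain_ae_eq_iUnion (hΩ : interior (closure Ω) = Ω) :
    Ω =ᵐ[volume] ⋃ K : T.cells, openSimplex K.1 := by
  filter_upwards [T.ae_mem_openSimplex] with x hx
  refine propext ⟨fun h => ?_, fun h => ?_⟩
  · obtain ⟨K, hK, hxK⟩ := hx (subset_closure h)
    exact mem_iUnion.mpr ⟨⟨K, hK⟩, hxK⟩
  · obtain ⟨K, hxK⟩ := mem_iUnion.mp h
    exact openSimplex_subset hΩ K.2 hxK

theorem eq_zero_of_vanishingOn (hΩ : interior (closure Ω) = Ω) {z : L2Grad d} (hz : z ∈ H10 Ω)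
    (h : ∀ K : T.cells, z ∈ vanishingOn (openSimplex K.1)) : z = 0 := by
  have h1 : ∀ᵐ x, ∀ K : T.cells, x ∈ openSimplex K.1 → z.fst x = 0 := ae_all_iff.mpr fun K =>
    (ae_restrict_iff' (measurableSet_openSimplex K.1)).mp (mem_vanishingOn.mp (h K)).1
  have h2 : ∀ᵐ x, ∀ K : T.cells, x ∈ openSimplex K.1 → z.snd x = 0 := ae_all_iff.mpr fun K =>
    (ae_restrict_iff' (measurableSet_openSimplex K.1)).mp (mem_vanishingOn.mp (h K)).2
  have hm := measurableSet_domain hΩ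
  refine WithLp.ofLp_injective 2 (Prod.ext ((Lp.eq_zero_iff_ae_eq_zero).mpr ?_)
    ((Lp.eq_zero_iff_ae_eq_zero).mpr ?_))
  · filter_upwards [h1, fst_ae_eq_zero_of_mem_H10 hm hz, T.ae_mem_openSimplex] with x h3 h4 h5
    by_cases hx : x ∈ Ω
    · obtain ⟨K, hK, hxK⟩ := h5 (subset_closure hx)
      exact h3 ⟨K, hK⟩ hxK
    · exact h4 hx
  · filter_upwards [h2, snd_ae_eq_zero_of_mem_H10 hm hz, T.ae_mem_openSimplex] with x h3 h4 h5
    by_cases hx : x ∈ Ω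
    · obtain ⟨K, hK, hxK⟩ := h5 (subset_closure hx)
      exact h3 ⟨K, hK⟩ hxK
    · exact h4 hx

/-- The functional `v ↦ ∫_Ω f v` for the piecewise constant function `f` with values `fK`. -/
def load (fK : T.cells → ℝ) : L2Grad d →L[ℝ] ℝ := ∑ K, fK K • cellIntegral K.1

theorem load_apply (fK : T.cells → ℝ) (v : L2Grad d) :
    T.load fK v = ∑ K, fK K * cellIntegral K.1 v := by
  simp [load]

theorem setIntegral_domain (hΩ : interior (closure Ω) = Ω) {g : Sp d → ℝ}
    (hg : ∀ K : T.cells, IntegrableOn g (openSimplex K.1)) :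
    ∫ x in Ω, g x = ∑ K : T.cells, ∫ x in openSimplex K.1, g x := by
  rw [setIntegral_congr_set (T.domain_ae_eq_iUnion hΩ)]
  exact integral_iUnion_fintype (fun K : T.cells => measurableSet_openSimplex K.1)
    (fun K K' h => disjoint_openSimplex K.2 K'.2 fun h' => h (Subtype.ext h')) hg

theorem integral_load (hΩ : interior (closure Ω) = Ω) {f : Sp d → ℝ} {fK : T.cells → ℝ}
    (hf : ∀ K : T.cells, ∀ᵐ x ∂(volume.restrict (openSimplex K.1)), f x = fK K) (v : L2Grad d) :
    ∫ x in Ω, f x * v.fst x = T.load fK v := by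
  have hi : ∀ K : T.cells, (fun x => fK K * v.fst x) =ᵐ[volume.restrict (openSimplex K.1)]
      fun x => f x * v.fst x := fun K => by
    filter_upwards [hf K] with x hx
    rw [hx]
  have hv : ∀ K : T.cells, IntegrableOn v.fst (openSimplex K.1) := fun K =>
    integrableOn_Lp_of_measure_ne_top v.fst fact_one_le_two_ennreal.elim
      (volume_openSimplex_ne_top K.1)
  rw [T.setIntegral_domain hΩ fun K => ((hv K).integrable.const_mul (fK K)).congr (hi K),
    load_apply]
  refine Finset.sum_congr rfl fun K _ => ?_
  rw [← integral_congr_ae (hi K), integral_const_mul, cellIntegral_apply]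

theorem load_eq_of_mem_H10 (fK : T.cells → ℝ) (K : T.cells) {z : L2Grad d}
    (hz : z ∈ H10 (openSimplex K.1)) : T.load fK z = fK K * cellIntegral K.1 z := by
  rw [load_apply, Finset.sum_eq_single K]
  · intro K' _ h
    rw [cellIntegral_eq_zero (H10_cell_le_vanishingOn h.symm hz), mul_zero]
  · intro h
    exact absurd (Finset.mem_univ K) h

theorem globalForm_toL2Grad_left (m : ℝ) (b : Sp d) (v : T.VH) (K : T.cells) {z : L2Grad d}
    (hz : z ∈ H10 (openSimplex K.1)) :
    globalForm m b (T.toL2Grad v) z = ⟪b, cellGrad v K.1⟫ * cellIntegral K.1 z := by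
  rw [← aForm_eq_globalForm_of_right (measurableSet_openSimplex K.1) m b _ hz, aForm, advForm,
    ← setIntegral_const_gradient m b _ hz]
  refine integral_congr_ae ?_
  rw [EventuallyEq, ae_restrict_iff' (measurableSet_openSimplex K.1)]
  filter_upwards [T.toL2Grad_snd_of_mem v K.2] with x hx hxK
  rw [hx hxK]

theorem globalForm_toL2Grad_right (hΩ : interior (closure Ω) = Ω) (m : ℝ) (b : Sp d) (v : T.VH)
    (K : T.cells) {z : L2Grad d} (hz : z ∈ H10 (openSimplex K.1)) :
    globalForm m b z (T.toL2Grad v) = -(⟪b, cellGrad v K.1⟫ * cellIntegral K.1 z) := by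
  rw [globalForm, inner_fst_dirDeriv_antisymm b
    (H10_mono (openSimplex_subset hΩ K.2) hz) (T.toL2Grad_mem_H10 hΩ v)]
  -- The values `0` and `1` of the diffusion coefficient isolate the advection term and show that
  -- the diffusion term is zero. Only the former changes sign when the arguments are swapped.
  have h1 := T.globalForm_toL2Grad_left 0 b v K hz
  have h2 := T.globalForm_toL2Grad_left 1 b v K hz
  rw [globalForm] at h1 h2
  rw [real_inner_comm]
  linear_combination (-m) * h1 + m * h2 - h1

section Solution

variable {T} {m : ℝ} {b : Sp d} {B : T.cells → L2Grad d}

/-- `v ↦ v - Σ_K (b · ∇v)|_K B_K`. -/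
def lift (b : Sp d) (B : T.cells → L2Grad d) : T.VH →ₗ[ℝ] L2Grad d where
  toFun v := T.toL2Grad v - ∑ K : T.cells, ⟪b, cellGrad v K.1⟫ • B K
  map_add' u v := by
    rw [← toL2GradL_apply, map_add, toL2GradL_apply, toL2GradL_apply, ← add_sub_add_comm,
      ← Finset.sum_add_distrib]
    congr 1
    refine Finset.sum_congr rfl fun K _ => ?_
    rw [cellGrad_add u v K.2, inner_add_right, add_smul]
  map_smul' r v := by
    rw [← toL2GradL_apply, map_smul, toL2GradL_apply, RingHom.id_apply, smul_sub, Finset.smul_sum]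
    congr 1
    refine Finset.sum_congr rfl fun K _ => ?_
    rw [cellGrad_smul r v K.2, real_inner_smul_right, mul_smul]

theorem lift_apply (v : T.VH) :
    lift b B v = T.toL2Grad v - ∑ K : T.cells, ⟪b, cellGrad v K.1⟫ • B K := rfl

/-- `β ↦ Σ_K β_K B_K`. -/
def bubbleSum (B : T.cells → L2Grad d) : (T.cells → ℝ) →ₗ[ℝ] L2Grad d :=
  Fintype.linearCombination ℝ B

theorem bubbleSum_apply (β : T.cells → ℝ) : bubbleSum B β = ∑ K, β K • B K := rfl

theorem range_bubbleSum : LinearMap.range (bubbleSum B) = Submodule.span ℝ (range B) :=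
  Fintype.range_linearCombination ℝ B

/-- Substituting `χ_K^α = -b^α B_K` contracts the sum over `α` to `-(b · ∇v) B_K`. -/
theorem withCorrectors_eq_lift (hd : 1 ≤ d) (hm : 0 < m) (hB : ∀ K, IsBubble m b K.1 (B K))
    {χ : T.cells → Fin d → L2Grad d} (hχ : ∀ K α, IsCorrector m b K.1 α (χ K α)) (v : T.VH) :
    T.withCorrectors χ v = lift b B v := by
  rw [withCorrectors, lift_apply, sub_eq_add_neg, ← Finset.sum_neg_distrib]
  congr 1
  refine Finset.sum_congr rfl fun K _ => ?_
  rw [← neg_smul, PiLp.inner_apply, ← Finset.sum_neg_distrib, Finset.sum_smul]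
  refine Finset.sum_congr rfl fun α _ => ?_
  rw [(hχ K α).eq_smul hd hm (hB K), smul_smul]
  congr 1
  simp

end Solution

end Mesh

end

/-! ### The multiscale spaces and the reduction to stabilized schemes -/

section

namespace Mesh

section Solution

variable {d : ℕ} {Ω : Set (Sp d)} {T : Mesh Ω} {m : ℝ} {b : Sp d} {B : T.cells → L2Grad d}

theorem lift_eq_sub_bubbleSum (v : T.VH) :
    lift b B v = T.toL2Grad v - bubbleSum B fun K => ⟪b, cellGrad v K.1⟫ := rfl

theorem bubbleSum_sub_mem_vanishingOn (hB : ∀ K, IsBubble m b K.1 (B K)) (β : T.cells → ℝ)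
    (K : T.cells) : bubbleSum B β - β K • B K ∈ vanishingOn (openSimplex K.1) := by
  classical
  rw [bubbleSum_apply, ← Finset.sum_erase_eq_sub (Finset.mem_univ K)]
  refine Submodule.sum_mem _ fun K' hK' => Submodule.smul_mem _ _ ?_
  exact H10_cell_le_vanishingOn (Finset.ne_of_mem_erase hK') (hB K').1

theorem globalForm_sub_left (m : ℝ) (b : Sp d) (u u' v : L2Grad d) :
    globalForm m b (u - u') v = globalForm m b u v - globalForm m b u' v :=
  LinearMap.map_sub₂ (globalBilin m b) u u' v

theorem globalForm_smul_left (m : ℝ) (b : Sp d) (r : ℝ) (u v : L2Grad d) :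
    globalForm m b (r • u) v = r * globalForm m b u v :=
  LinearMap.map_smul₂ (globalBilin m b) r u v

theorem globalForm_add_left (m : ℝ) (b : Sp d) (u u' v : L2Grad d) :
    globalForm m b (u + u') v = globalForm m b u v + globalForm m b u' v :=
  LinearMap.map_add₂ (globalBilin m b) u u' v

theorem globalForm_add_right (m : ℝ) (b : Sp d) (u v v' : L2Grad d) :
    globalForm m b u (v + v') = globalForm m b u v + globalForm m b u v' :=
  map_add (globalBilin m b u) v v'

theorem globalForm_bubbleSum_of_mem (hB : ∀ K, IsBubble m b K.1 (B K)) (β : T.cells → ℝ)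
    (K : T.cells) {z : L2Grad d} (hz : z ∈ H10 (openSimplex K.1)) :
    globalForm m b (bubbleSum B β) z = β K * cellIntegral K.1 z := by
  have h1 := globalForm_eq_zero_of_vanishingOn (measurableSet_openSimplex K.1) m b
    (bubbleSum_sub_mem_vanishingOn hB β K) hz
  rw [globalForm_sub_left, globalForm_smul_left, (isBubble_iff.mp (hB K)).2 z hz, one_smul] at h1
  linarith

/-- The bubble coefficients in `lift` are exactly those that cancel the residual `b · ∇v` on each
element. -/
theorem globalForm_lift_of_mem (hB : ∀ K, IsBubble m b K.1 (B K)) (v : T.VH)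
    (K : T.cells) {z : L2Grad d} (hz : z ∈ H10 (openSimplex K.1)) :
    globalForm m b (lift b B v) z = 0 := by
  rw [lift_eq_sub_bubbleSum, globalForm_sub_left, T.globalForm_toL2Grad_left m b v K hz,
    globalForm_bubbleSum_of_mem hB _ K hz, sub_self]

theorem bubbleSum_mem (hΩ : interior (closure Ω) = Ω) (hB : ∀ K, IsBubble m b K.1 (B K))
    (β : T.cells → ℝ) : bubbleSum B β ∈ H10 Ω :=
  Submodule.sum_mem _ fun K _ => Submodule.smul_mem _ _
    (H10_mono (openSimplex_subset hΩ K.2) (hB K).1)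

theorem lift_mem (hΩ : interior (closure Ω) = Ω) (hB : ∀ K, IsBubble m b K.1 (B K))
    (v : T.VH) : lift b B v ∈ H10 Ω :=
  Submodule.sub_mem _ (T.toL2Grad_mem_H10 hΩ v) (bubbleSum_mem hΩ hB _)

theorem globalForm_bubbleSum_toL2Grad (hΩ : interior (closure Ω) = Ω)
    (hB : ∀ K, IsBubble m b K.1 (B K)) (β : T.cells → ℝ) (v : T.VH) :
    globalForm m b (bubbleSum B β) (T.toL2Grad v) =
      -∑ K : T.cells, β K * ⟪b, cellGrad v K.1⟫ * cellIntegral K.1 (B K) := by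
  rw [bubbleSum_apply, ← globalBilin_apply, map_sum, LinearMap.sum_apply, ← Finset.sum_neg_distrib]
  refine Finset.sum_congr rfl fun K _ => ?_
  rw [globalBilin_apply, globalForm_smul_left, T.globalForm_toL2Grad_right hΩ m b v K (hB K).1]
  ring

theorem isMultiscale_lift (hΩ : interior (closure Ω) = Ω) (hB : ∀ K, IsBubble m b K.1 (B K))
    (φ : T.VH) : T.IsMultiscale m b φ (lift b B φ) := by
  refine ⟨lift_mem hΩ hB φ, fun K hK => ⟨fun z hz => ?_, ?_⟩⟩
  · rw [aForm_eq_globalForm_of_right (measurableSet_openSimplex K) m b _ hz]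
    exact globalForm_lift_of_mem hB φ ⟨K, hK⟩ hz
  -- Inside `K` only the bubble of `K` survives, so this is the difference between `lift b B φ` and
  -- `φ` there.
  · refine eqOnBoundary_iff.mpr ⟨-(⟪b, cellGrad φ K⟫ • B ⟨K, hK⟩),
      Submodule.neg_mem _ (Submodule.smul_mem _ _ (hB ⟨K, hK⟩).1), ?_⟩
    have := bubbleSum_sub_mem_vanishingOn hB (fun K => ⟪b, cellGrad φ K.1⟫) ⟨K, hK⟩
    rw [lift_eq_sub_bubbleSum]
    convert this using 1
    abel

/-- On each element, `w - w'` coincides with an element of `H¹₀(K)` that solves the homogeneous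
problem; tested against itself, it is zero. -/
theorem IsMultiscale.eq (hd : 1 ≤ d) (hm : 0 < m) (hΩ : interior (closure Ω) = Ω) {φ : T.VH}
    {w w' : L2Grad d} (hw : T.IsMultiscale m b φ w) (hw' : T.IsMultiscale m b φ w') : w = w' := by
  refine sub_eq_zero.mp (T.eq_zero_of_vanishingOn hΩ (Submodule.sub_mem _ hw.1 hw'.1) ?_)
  rintro ⟨K, hK⟩
  obtain ⟨h1, h2⟩ := hw.2 K hK
  obtain ⟨k1, k2⟩ := hw'.2 K hK
  obtain ⟨z, hz, hzv⟩ := eqOnBoundary_iff.mp h2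
  obtain ⟨z', hz', hzv'⟩ := eqOnBoundary_iff.mp k2
  have hmeas := measurableSet_openSimplex K
  have hdz : z - z' ∈ H10 (openSimplex K) := Submodule.sub_mem _ hz hz'
  have hvan : (z - z') - (w - w') ∈ vanishingOn (openSimplex K) := by
    convert Submodule.sub_mem _ hzv hzv' using 1
    abel
  have h0 : z - z' = 0 := by
    refine eq_zero_of_globalForm_self_eq_zero hd (isBounded_openSimplex K) hm b hdz ?_
    have h3 := globalForm_eq_zero_of_vanishingOn hmeas m b hvan hdz
    rw [globalForm_sub_left, globalForm_sub_left m b w w',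
      ← aForm_eq_globalForm_of_right hmeas m b w hdz,
      ← aForm_eq_globalForm_of_right hmeas m b w' hdz, h1 _ hdz, k1 _ hdz] at h3
    linarith
  rw [h0, zero_sub] at hvan
  simpa using Submodule.neg_mem _ hvan

/-- By uniqueness, `lift` maps the nodal basis onto the multiscale basis; being linear, it maps the
span onto the span. -/
theorem VHadv_eq_range (hd : 1 ≤ d) (hm : 0 < m) (hΩ : interior (closure Ω) = Ω)
    (hB : ∀ K, IsBubble m b K.1 (B K)) : T.VHadv m b = LinearMap.range (lift b B) := by
  rw [LinearMap.range_eq_map, ← T.span_nodal hΩ, Submodule.map_span, VHadv]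
  congr 1
  ext w
  constructor
  · rintro ⟨φ, hφ, hw⟩
    exact ⟨φ, hφ, (isMultiscale_lift hΩ hB φ).eq hd hm hΩ hw⟩
  · rintro ⟨φ, hφ, rfl⟩
    exact ⟨φ, hφ, isMultiscale_lift hΩ hB φ⟩

theorem existsUnique_isBubble (hd : 1 ≤ d) (hm : 0 < m) (b : Sp d) (K : Finset (Sp d)) :
    ∃! B, IsBubble m b K B := by
  simp only [isBubble_iff]
  exact existsUnique_solvesCell hd hm b K 1

theorem VHBadv_eq_sup (hd : 1 ≤ d) (hm : 0 < m) (hΩ : interior (closure Ω) = Ω)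
    (hB : ∀ K, IsBubble m b K.1 (B K)) :
    T.VHBadv m b = LinearMap.range (lift b B) ⊔ LinearMap.range (bubbleSum B) := by
  rw [VHBadv, VHadv_eq_range hd hm hΩ hB, range_bubbleSum]
  congr 2
  ext u
  constructor
  · rintro ⟨K, hK, hu⟩
    exact ⟨⟨K, hK⟩, (existsUnique_isBubble hd hm b K).unique (hB ⟨K, hK⟩) hu⟩
  · rintro ⟨K, rfl⟩
    exact ⟨K.1, K.2, hB K⟩

theorem mem_VHBadv_iff (hd : 1 ≤ d) (hm : 0 < m) (hΩ : interior (closure Ω) = Ω)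
    (hB : ∀ K, IsBubble m b K.1 (B K)) {u : L2Grad d} :
    u ∈ T.VHBadv m b ↔ ∃ (v : T.VH) (β : T.cells → ℝ), lift b B v + bubbleSum B β = u := by
  rw [VHBadv_eq_sup hd hm hΩ hB, Submodule.mem_sup]
  simp

/-- A function of `V_H` which is a combination of bubbles has zero gradient, since the mean of the
gradient of a bubble is zero. -/
theorem cellGrad_eq_zero (hB : ∀ K, IsBubble m b K.1 (B K)) {v : T.VH} {γ : T.cells → ℝ}
    (h : T.toL2Grad v = bubbleSum B γ) (K : T.cells) : cellGrad v K.1 = 0 := by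
  let c := cellGrad v K.1
  have hmeas := measurableSet_openSimplex K.1
  have h1 : ∫ x in openSimplex K.1, ⟪c, (T.toL2Grad v).snd x⟫ =
      volume.real (openSimplex K.1) * ⟪c, c⟫ := by
    rw [← smul_eq_mul, ← setIntegral_const]
    refine setIntegral_congr_ae hmeas ?_
    filter_upwards [T.toL2Grad_snd_of_mem v K.2] with x hx hxK
    rw [hx hxK]
  have h2 : ∫ x in openSimplex K.1, ⟪c, (T.toL2Grad v).snd x⟫ =
      ∫ x in openSimplex K.1, ⟪c, (γ K • B K).snd x⟫ := by
    have hv := (mem_vanishingOn.mp (bubbleSum_sub_mem_vanishingOn hB γ K)).2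
    rw [← h] at hv
    refine integral_congr_ae ?_
    filter_upwards [hv, ae_restrict_of_ae (Lp.coeFn_sub (T.toL2Grad v).snd (γ K • B K).snd)]
      with x h3 h4
    have h5 : (T.toL2Grad v).snd x - (γ K • B K).snd x = 0 := h4.symm.trans h3
    rw [sub_eq_zero.mp h5]
  rw [h1, setIntegral_inner_snd_eq_zero hmeas (volume_openSimplex_ne_top K.1) c
    (Submodule.smul_mem _ _ (hB K).1)] at h2
  have hvol : volume.real (openSimplex K.1) ≠ 0 := by
    refine (ENNReal.toReal_pos ?_ (volume_openSimplex_ne_top K.1)).ne'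
    exact ((isOpen_openSimplex K.1).measure_pos volume ⟨_, centroid_mem_openSimplex K.2⟩).ne'
  exact inner_self_eq_zero.mp ((mul_eq_zero.mp h2).resolve_left hvol)

theorem cellIntegral_pos (hd : 1 ≤ d) (hm : 0 < m) (hB : ∀ K, IsBubble m b K.1 (B K))
    (K : T.cells) : 0 < cellIntegral K.1 (B K) :=
  cellIntegral_bubble_pos hd hm (hB K) ⟨_, centroid_mem_openSimplex K.2⟩

/-- The relation makes `v` a combination of bubbles, so its cell gradients are zero and Poincaré
gives `v = 0`. Testing the remaining bubble sum with `B K` gives `β K ∫ B K = 0`. -/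
theorem eq_zero_of_lift_add_bubbleSum (hd : 1 ≤ d) (hm : 0 < m) (hΩ : interior (closure Ω) = Ω)
    (hB : ∀ K, IsBubble m b K.1 (B K)) {v : T.VH} {β : T.cells → ℝ}
    (h : lift b B v + bubbleSum B β = 0) : v = 0 ∧ β = 0 := by
  have h1 : T.toL2Grad v = bubbleSum B ((fun K => ⟪b, cellGrad v K.1⟫) - β) := by
    rw [map_sub, ← sub_eq_zero, ← h, lift_eq_sub_bubbleSum]
    abel
  have hg := cellGrad_eq_zero hB h1
  have hsnd : (T.toL2Grad v).snd = 0 := by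
    rw [Lp.eq_zero_iff_ae_eq_zero]
    filter_upwards [T.toL2Grad_snd_ae v] with x hx
    rw [hx]
    refine Finset.sum_eq_zero fun K hK => ?_
    rw [hg ⟨K, hK⟩]
    simp
  have hv : T.toL2Grad v = 0 := eq_zero_of_mem_H10_of_snd_eq_zero hd T.isBounded_domain
    (T.toL2Grad_mem_H10 hΩ v) hsnd
  have hv0 := T.VH_eq_zero_of_toL2Grad_eq_zero hv
  refine ⟨hv0, funext fun K => ?_⟩
  rw [hv0, map_zero, zero_add] at h
  have h2 := globalForm_bubbleSum_of_mem hB β K (hB K).1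
  rw [h, ← globalBilin_apply, LinearMap.map_zero₂] at h2
  exact (mul_eq_zero.mp h2.symm).resolve_right (cellIntegral_pos hd hm hB K).ne'

theorem existsUnique_decomposition (hd : 1 ≤ d) (hm : 0 < m) (hΩ : interior (closure Ω) = Ω)
    (hB : ∀ K, IsBubble m b K.1 (B K)) {u : L2Grad d} (hu : u ∈ T.VHBadv m b) :
    ∃! p : T.VH × (T.cells → ℝ), u = lift b B p.1 + bubbleSum B p.2 := by
  obtain ⟨v, β, rfl⟩ := (mem_VHBadv_iff hd hm hΩ hB).mp hu
  refine ⟨(v, β), rfl, ?_⟩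
  rintro ⟨v', β'⟩ h
  have : lift b B (v' - v) + bubbleSum B (β' - β) = 0 := by
    rw [map_sub, map_sub, sub_add_sub_comm, sub_eq_zero]
    exact h.symm
  obtain ⟨h1, h2⟩ := eq_zero_of_lift_add_bubbleSum hd hm hΩ hB this
  exact Prod.ext (sub_eq_zero.mp h1) (sub_eq_zero.mp h2)

theorem lift_injective (hd : 1 ≤ d) (hm : 0 < m) (hΩ : interior (closure Ω) = Ω)
    (hB : ∀ K, IsBubble m b K.1 (B K)) : Function.Injective (lift b B) := by
  refine (injective_iff_map_eq_zero _).mpr fun v hv => ?_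
  refine (eq_zero_of_lift_add_bubbleSum hd hm hΩ hB (β := 0) ?_).1
  rw [hv, map_zero, add_zero]

variable {f : Sp d → ℝ} {fK : T.cells → ℝ}

theorem isGalerkin_iff (hΩ : interior (closure Ω) = Ω)
    (hf : ∀ K : T.cells, ∀ᵐ x ∂(volume.restrict (openSimplex K.1)), f x = fK K)
    {W : Submodule ℝ (L2Grad d)} (hW : W ≤ H10 Ω) {u : L2Grad d} :
    T.IsGalerkin m b f W u ↔ u ∈ W ∧ ∀ v ∈ W, globalForm m b u v = T.load fK v := by
  refine and_congr_right fun _ => forall₂_congr fun v hv => ?_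
  rw [aForm_eq_globalForm_of_right (measurableSet_domain hΩ) m b u (hW hv),
    T.integral_load hΩ hf]

theorem existsUnique_isGalerkin (hd : 1 ≤ d) (hm : 0 < m) (hΩ : interior (closure Ω) = Ω)
    (hf : ∀ K : T.cells, ∀ᵐ x ∂(volume.restrict (openSimplex K.1)), f x = fK K)
    {W : Submodule ℝ (L2Grad d)} [FiniteDimensional ℝ W] (hW : W ≤ H10 Ω) :
    ∃! u, T.IsGalerkin m b f W u := by
  have : CompleteSpace W := FiniteDimensional.complete ℝ W
  simp only [isGalerkin_iff hΩ hf hW]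
  exact existsUnique_variational hd T.isBounded_domain hm b hW _

theorem range_lift_le (hΩ : interior (closure Ω) = Ω) (hB : ∀ K, IsBubble m b K.1 (B K)) :
    LinearMap.range (lift b B) ≤ H10 Ω := by
  rintro _ ⟨v, rfl⟩
  exact lift_mem hΩ hB v

theorem range_bubbleSum_le (hΩ : interior (closure Ω) = Ω) (hB : ∀ K, IsBubble m b K.1 (B K)) :
    LinearMap.range (bubbleSum B) ≤ H10 Ω := by
  rintro _ ⟨β, rfl⟩
  exact bubbleSum_mem hΩ hB β

theorem isAdvMsFEMLin_lift_iff (hd : 1 ≤ d) (hm : 0 < m) (hΩ : interior (closure Ω) = Ω)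
    (hf : ∀ K : T.cells, ∀ᵐ x ∂(volume.restrict (openSimplex K.1)), f x = fK K)
    (hB : ∀ K, IsBubble m b K.1 (B K)) (u : T.VH) : T.IsAdvMsFEMLin m b f (lift b B u) ↔
      ∀ v : T.VH, globalForm m b (lift b B u) (lift b B v) = T.load fK (lift b B v) := by
  rw [IsAdvMsFEMLin, VHadv_eq_range hd hm hΩ hB, isGalerkin_iff hΩ hf (range_lift_le hΩ hB)]
  constructor
  · exact fun h v => h.2 _ ⟨v, rfl⟩
  · refine fun h => ⟨⟨u, rfl⟩, ?_⟩
    rintro _ ⟨v, rfl⟩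
    exact h v

/-- Modulo bubbles, `lift b B v` equals `v`, so once bubbles are test functions the plain `P₁`
functions may replace the multiscale ones. -/
theorem isAdvMsFEMLinB_iff (hd : 1 ≤ d) (hm : 0 < m) (hΩ : interior (closure Ω) = Ω)
    (hf : ∀ K : T.cells, ∀ᵐ x ∂(volume.restrict (openSimplex K.1)), f x = fK K)
    (hB : ∀ K, IsBubble m b K.1 (B K)) (u : T.VH) (β : T.cells → ℝ) :
    T.IsAdvMsFEMLinB m b f (lift b B u + bubbleSum B β) ↔
      (∀ γ : T.cells → ℝ, globalForm m b (lift b B u + bubbleSum B β) (bubbleSum B γ) =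
        T.load fK (bubbleSum B γ)) ∧
      ∀ v : T.VH, globalForm m b (lift b B u + bubbleSum B β) (T.toL2Grad v) =
        T.load fK (T.toL2Grad v) := by
  rw [IsAdvMsFEMLinB, VHBadv_eq_sup hd hm hΩ hB,
    isGalerkin_iff hΩ hf (sup_le (range_lift_le hΩ hB) (range_bubbleSum_le hΩ hB))]
  have hsplit : ∀ v : T.VH, T.toL2Grad v =
      lift b B v + bubbleSum B fun K => ⟪b, cellGrad v K.1⟫ := fun v => by
    rw [lift_eq_sub_bubbleSum, sub_add_cancel]
  constructor
  · rintro ⟨-, h⟩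
    refine ⟨fun γ => h _ (Submodule.mem_sup_right ⟨γ, rfl⟩), fun v => h _ ?_⟩
    rw [hsplit]
    exact Submodule.add_mem_sup ⟨v, rfl⟩ ⟨_, rfl⟩
  · rintro ⟨h1, h2⟩
    refine ⟨Submodule.add_mem_sup ⟨u, rfl⟩ ⟨β, rfl⟩, fun w hw => ?_⟩
    obtain ⟨_, ⟨v, rfl⟩, _, ⟨γ, rfl⟩, rfl⟩ := Submodule.mem_sup.mp hw
    have h3 := h2 v
    rw [hsplit, globalForm_add_right, map_add, h1] at h3
    rw [globalForm_add_right, map_add, h1, add_right_cancel h3]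

theorem globalForm_bubbleSum_right (u : L2Grad d) (γ : T.cells → ℝ) :
    globalForm m b u (bubbleSum B γ) = ∑ K, γ K * globalForm m b u (B K) := by
  rw [← globalBilin_apply, bubbleSum_apply, map_sum]
  simp

theorem load_bubbleSum (hB : ∀ K, IsBubble m b K.1 (B K)) (γ : T.cells → ℝ) :
    T.load fK (bubbleSum B γ) = ∑ K, γ K * (fK K * cellIntegral K.1 (B K)) := by
  rw [bubbleSum_apply, map_sum]
  refine Finset.sum_congr rfl fun K _ => ?_
  rw [map_smul, T.load_eq_of_mem_H10 fK K (hB K).1, smul_eq_mul]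

theorem globalForm_lift_add_bubbleSum (hB : ∀ K, IsBubble m b K.1 (B K)) (u : T.VH)
    (β : T.cells → ℝ) (K : T.cells) :
    globalForm m b (lift b B u + bubbleSum B β) (B K) = β K * cellIntegral K.1 (B K) := by
  rw [globalForm_add_left, globalForm_lift_of_mem hB u K (hB K).1,
    globalForm_bubbleSum_of_mem hB β K (hB K).1, zero_add]

/-- The equations decouple element by element: the form kills `lift` against bubbles, and distinct
bubbles do not interact. What remains is divided by the positive `∫ B K`. -/
theorem globalForm_bubbleSum_eq_load_iff (hd : 1 ≤ d) (hm : 0 < m)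
    (hB : ∀ K, IsBubble m b K.1 (B K)) (u : T.VH) (β : T.cells → ℝ) :
    (∀ γ : T.cells → ℝ, globalForm m b (lift b B u + bubbleSum B β) (bubbleSum B γ) =
        T.load fK (bubbleSum B γ)) ↔ ∀ K, β K = fK K := by
  classical
  simp only [globalForm_bubbleSum_right, load_bubbleSum hB, globalForm_lift_add_bubbleSum hB]
  constructor
  · intro h K
    have h1 := h (Pi.single K 1)
    rw [Finset.sum_eq_single K (fun K' _ h => by simp [Pi.single_eq_of_ne h]) (by simp),
      Finset.sum_eq_single K (fun K' _ h => by simp [Pi.single_eq_of_ne h]) (by simp),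
      Pi.single_eq_same, one_mul, one_mul] at h1
    exact mul_right_cancel₀ (cellIntegral_pos hd hm hB K).ne' h1
  · intro h γ
    simp only [h]

theorem tauB_mul_volume (B : T.cells → L2Grad d) (K : T.cells) :
    volume.real (openSimplex K.1) * T.tauB B K = cellIntegral K.1 (B K) := by
  have hvol : volume.real (openSimplex K.1) ≠ 0 := by
    refine (ENNReal.toReal_pos ?_ (volume_openSimplex_ne_top K.1)).ne'
    exact ((isOpen_openSimplex K.1).measure_pos volume ⟨_, centroid_mem_openSimplex K.2⟩).ne'
  rw [tauB, cellIntegral_apply, mul_inv_cancel_left₀ hvol]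

theorem aStab_tauB (u v : T.VH) : T.aStab b (T.tauB B) u v =
    ∑ K : T.cells, ⟪b, cellGrad u K.1⟫ * ⟪b, cellGrad v K.1⟫ * cellIntegral K.1 (B K) := by
  refine Finset.sum_congr rfl fun K _ => ?_
  have h : ∫ x in openSimplex K.1, T.tauB B K * ⟪b, gradient (u : Sp d → ℝ) x⟫ *
      ⟪b, gradient (v : Sp d → ℝ) x⟫ = ∫ _ in openSimplex K.1,
        T.tauB B K * ⟪b, cellGrad u K.1⟫ * ⟪b, cellGrad v K.1⟫ :=
    setIntegral_congr_fun (measurableSet_openSimplex K.1) fun x hx => by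
      simp only [gradient_eq_cellGrad u K.2 hx, gradient_eq_cellGrad v K.2 hx]
  rw [h, setIntegral_const, smul_eq_mul, ← tauB_mul_volume]
  ring

theorem FStab_tauB (hf : ∀ K : T.cells, ∀ᵐ x ∂(volume.restrict (openSimplex K.1)), f x = fK K)
    (v : T.VH) : T.FStab b f (T.tauB B) v =
      ∑ K : T.cells, fK K * ⟪b, cellGrad v K.1⟫ * cellIntegral K.1 (B K) := by
  refine Finset.sum_congr rfl fun K _ => ?_
  have h : ∫ x in openSimplex K.1, T.tauB B K * f x * ⟪b, gradient (v : Sp d → ℝ) x⟫ =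
      ∫ _ in openSimplex K.1, T.tauB B K * fK K * ⟪b, cellGrad v K.1⟫ := by
    refine integral_congr_ae ?_
    filter_upwards [hf K, ae_restrict_mem (measurableSet_openSimplex K.1)] with x h1 h2
    rw [h1, gradient_eq_cellGrad v K.2 h2]
  rw [h, setIntegral_const, smul_eq_mul, ← tauB_mul_volume]
  ring

theorem advForm_gradient (hΩ : interior (closure Ω) = Ω) (u v : T.VH) :
    advForm m b Ω (gradient (u : Sp d → ℝ)) v (gradient (v : Sp d → ℝ)) =
      globalForm m b (T.toL2Grad u) (T.toL2Grad v) := by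
  rw [← aForm_eq_globalForm_of_right (measurableSet_domain hΩ) m b _ (T.toL2Grad_mem_H10 hΩ v),
    aForm, advForm, advForm]
  refine integral_congr_ae (ae_restrict_of_ae ?_)
  filter_upwards [T.toL2Grad_fst v, T.toL2Grad_snd v, T.toL2Grad_snd u] with x h1 h2 h3
  rw [h1, h2, h3]

theorem integral_mul_VH (hΩ : interior (closure Ω) = Ω)
    (hf : ∀ K : T.cells, ∀ᵐ x ∂(volume.restrict (openSimplex K.1)), f x = fK K) (v : T.VH) :
    ∫ x in Ω, f x * (v : Sp d → ℝ) x = T.load fK (T.toL2Grad v) := by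
  rw [← T.integral_load hΩ hf]
  refine integral_congr_ae (ae_restrict_of_ae ?_)
  filter_upwards [T.toL2Grad_fst v] with x h1
  rw [h1]

/-- The minus sign in `lift` and the one from antisymmetry cancel, whence the positive
stabilization. -/
theorem globalForm_lift_toL2Grad (hΩ : interior (closure Ω) = Ω)
    (hB : ∀ K, IsBubble m b K.1 (B K)) (u v : T.VH) :
    globalForm m b (lift b B u) (T.toL2Grad v) =
      globalForm m b (T.toL2Grad u) (T.toL2Grad v) + T.aStab b (T.tauB B) u v := by
  rw [lift_eq_sub_bubbleSum, globalForm_sub_left, globalForm_bubbleSum_toL2Grad hΩ hB, aStab_tauB]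
  ring

/-- Elimination of the bubbles from the method with bubbles. -/
theorem isAdvMsFEMLinB_iff_isSUPG (hd : 1 ≤ d) (hm : 0 < m) (hΩ : interior (closure Ω) = Ω)
    (hf : ∀ K : T.cells, ∀ᵐ x ∂(volume.restrict (openSimplex K.1)), f x = fK K)
    (hB : ∀ K, IsBubble m b K.1 (B K)) (u : T.VH) (β : T.cells → ℝ) :
    T.IsAdvMsFEMLinB m b f (lift b B u + bubbleSum B β) ↔
      (∀ K, β K = fK K) ∧ T.IsSUPG m b f (T.tauB B) u := by
  rw [isAdvMsFEMLinB_iff hd hm hΩ hf hB, globalForm_bubbleSum_eq_load_iff hd hm hB]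
  refine and_congr_right fun hβ => forall_congr' fun v => ?_
  rw [globalForm_add_left, globalForm_lift_toL2Grad hΩ hB, globalForm_bubbleSum_toL2Grad hΩ hB,
    advForm_gradient hΩ, integral_mul_VH hΩ hf, FStab_tauB hf]
  simp only [hβ]
  -- The bubbles `f_K B_K` contribute `-F_stab(v)` on the left; moved across, this gives the SUPG
  -- right-hand side.
  rw [← sub_eq_add_neg, sub_eq_iff_eq_add]

/-- Elimination of the correctors from the method without bubbles. -/
theorem isAdvMsFEMLin_iff_isSUPGOpposite (hd : 1 ≤ d) (hm : 0 < m) (hΩ : interior (closure Ω) = Ω)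
    (hf : ∀ K : T.cells, ∀ᵐ x ∂(volume.restrict (openSimplex K.1)), f x = fK K)
    (hB : ∀ K, IsBubble m b K.1 (B K)) (u : T.VH) :
    T.IsAdvMsFEMLin m b f (lift b B u) ↔ T.IsSUPGOpposite m b f (T.tauB B) u := by
  rw [isAdvMsFEMLin_lift_iff hd hm hΩ hf hB]
  refine forall_congr' fun v => ?_
  -- The bubble part of the test function is invisible to the form, so the left-hand side is that of
  -- the method with bubbles.
  have h1 : globalForm m b (lift b B u) (lift b B v) =
      globalForm m b (lift b B u) (T.toL2Grad v) := by
    have h2 : globalForm m b (lift b B u) (bubbleSum B fun K => ⟪b, cellGrad v K.1⟫) = 0 := by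
      rw [globalForm_bubbleSum_right]
      refine Finset.sum_eq_zero fun K _ => ?_
      rw [globalForm_lift_of_mem hB u K (hB K).1, mul_zero]
    have h3 := globalForm_add_right m b (lift b B u) (lift b B v)
      (bubbleSum B fun K => ⟪b, cellGrad v K.1⟫)
    rw [lift_eq_sub_bubbleSum v, sub_add_cancel, h2, add_zero] at h3
    rw [lift_eq_sub_bubbleSum v, h3]
  -- The load does see the bubble part of `lift b B v`, which produces the opposite sign of
  -- `F_stab`.
  have h4 : T.load fK (lift b B v) =
      T.load fK (T.toL2Grad v) - T.FStab b f (T.tauB B) v := by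
    rw [lift_eq_sub_bubbleSum, map_sub, load_bubbleSum hB, FStab_tauB hf]
    congr 1
    refine Finset.sum_congr rfl fun K _ => ?_
    ring
  rw [h1, h4, globalForm_lift_toL2Grad hΩ hB, advForm_gradient hΩ, integral_mul_VH hΩ hf]

end Solution

end Mesh

end

end AdvMsFEM

end

theorem mainTheorem4 {d : ℕ} (hd : 1 ≤ d) (Ω : Set (AdvMsFEM.Sp d))
    (hΩ : interior (closure Ω) = Ω) (T : AdvMsFEM.Mesh Ω)
    (m : ℝ) (hm : 0 < m) (b : AdvMsFEM.Sp d)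
    (f : AdvMsFEM.Sp d → ℝ) (fK : T.cells → ℝ)
    (hf : ∀ K : T.cells, ∀ᵐ x ∂(volume.restrict (AdvMsFEM.openSimplex K.1)), f x = fK K) :
    -- the bubbles, the correctors and the multiscale basis functions are well defined
    (∀ K ∈ T.cells, ∃! B, AdvMsFEM.IsBubble m b K B) ∧
    (∀ K ∈ T.cells, ∀ α, ∃! χ, AdvMsFEM.IsCorrector m b K α χ) ∧
    (∀ x ∈ T.complex.vertices ∩ Ω, ∃! φ : T.VH, (φ : AdvMsFEM.Sp d → ℝ) x = 1 ∧
      ∀ y ∈ T.complex.vertices ∩ Ω, y ≠ x → (φ : AdvMsFEM.Sp d → ℝ) y = 0) ∧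
    (∀ φ : T.VH, T.IsNodal φ → ∃! w, T.IsMultiscale m b φ w) ∧
    ∀ (B : T.cells → AdvMsFEM.L2Grad d) (χ : T.cells → Fin d → AdvMsFEM.L2Grad d),
      (∀ K, AdvMsFEM.IsBubble m b K.1 (B K)) →
      (∀ K α, AdvMsFEM.IsCorrector m b K.1 α (χ K α)) →
      -- the method with bubbles
      ((∃! u, T.IsAdvMsFEMLinB m b f u) ∧
        (∀ u ∈ T.VHBadv m b, ∃! p : T.VH × (T.cells → ℝ),
          u = T.withCorrectors χ p.1 + ∑ K, p.2 K • B K) ∧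
        (∀ (uH : T.VH) (β : T.cells → ℝ),
          T.IsAdvMsFEMLinB m b f (T.withCorrectors χ uH + ∑ K, β K • B K) ↔
            (∀ K, β K = fK K) ∧ T.IsSUPG m b f (T.tauB B) uH) ∧
        (∃! uH : T.VH, T.IsSUPG m b f (T.tauB B) uH)) ∧
      -- the method without bubbles
      ((∃! u, T.IsAdvMsFEMLin m b f u) ∧
        (∀ u ∈ T.VHadv m b, ∃! uH : T.VH, u = T.withCorrectors χ uH) ∧
        (∀ uH : T.VH,
          T.IsAdvMsFEMLin m b f (T.withCorrectors χ uH) ↔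
            T.IsSUPGOpposite m b f (T.tauB B) uH) ∧
        (∃! uH : T.VH, T.IsSUPGOpposite m b f (T.tauB B) uH)) := by
  have hbubble : ∀ K : T.cells, ∃ B, AdvMsFEM.IsBubble m b K.1 B := fun K =>
    (AdvMsFEM.Mesh.existsUnique_isBubble hd hm b K.1).exists
  refine ⟨fun K _ => AdvMsFEM.Mesh.existsUnique_isBubble hd hm b K, fun K _ α => ?_,
    fun x hx => T.existsUnique_nodal hΩ hx, fun φ _ => ?_, fun B χ hB hχ => ?_⟩
  · simp only [AdvMsFEM.isCorrector_iff]
    exact AdvMsFEM.existsUnique_solvesCell hd hm b K _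
  · choose B hB using hbubble
    exact ⟨AdvMsFEM.Mesh.lift b B φ, AdvMsFEM.Mesh.isMultiscale_lift hΩ hB φ,
      fun w hw => hw.eq hd hm hΩ (AdvMsFEM.Mesh.isMultiscale_lift hΩ hB φ)⟩
  simp only [AdvMsFEM.Mesh.withCorrectors_eq_lift hd hm hB hχ,
    ← AdvMsFEM.Mesh.bubbleSum_apply]
  have hiffB := AdvMsFEM.Mesh.isAdvMsFEMLinB_iff_isSUPG hd hm hΩ hf hB
  have hiff := AdvMsFEM.Mesh.isAdvMsFEMLin_iff_isSUPGOpposite hd hm hΩ hf hB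
  have hrange := AdvMsFEM.Mesh.VHadv_eq_range hd hm hΩ hB
  have hinj := AdvMsFEM.Mesh.lift_injective hd hm hΩ hB
  have hexB : ∃! u, T.IsAdvMsFEMLinB m b f u := by
    simp only [AdvMsFEM.Mesh.IsAdvMsFEMLinB, AdvMsFEM.Mesh.VHBadv_eq_sup hd hm hΩ hB]
    exact AdvMsFEM.Mesh.existsUnique_isGalerkin hd hm hΩ hf
      (sup_le (AdvMsFEM.Mesh.range_lift_le hΩ hB) (AdvMsFEM.Mesh.range_bubbleSum_le hΩ hB))
  have hex : ∃! u, T.IsAdvMsFEMLin m b f u := by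
    simp only [AdvMsFEM.Mesh.IsAdvMsFEMLin, hrange]
    exact AdvMsFEM.Mesh.existsUnique_isGalerkin hd hm hΩ hf (AdvMsFEM.Mesh.range_lift_le hΩ hB)
  refine ⟨⟨hexB, fun u hu => AdvMsFEM.Mesh.existsUnique_decomposition hd hm hΩ hB hu, hiffB, ?_⟩,
    hex, fun u hu => ?_, hiff, ?_⟩
  · obtain ⟨u, hu⟩ := hexB.exists
    -- The SUPG scheme inherits well-posedness: the Galerkin solution supplies a solution, and two
    -- SUPG solutions, completed by the same bubble coefficients `fK`, give the same Galerkin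
    -- solution.
    obtain ⟨v, β, rfl⟩ := (AdvMsFEM.Mesh.mem_VHBadv_iff hd hm hΩ hB).mp hu.1
    refine ⟨v, ((hiffB v β).mp hu).2, fun v' hv' => hinj ?_⟩
    have h1 := hexB.unique ((hiffB v' fK).mpr ⟨fun _ => rfl, hv'⟩)
      ((hiffB v fK).mpr ⟨fun _ => rfl, ((hiffB v β).mp hu).2⟩)
    exact add_right_cancel h1
  · rw [hrange] at hu
    obtain ⟨v, rfl⟩ := hu
    exact ⟨v, rfl, fun v' hv' => hinj hv'.symm⟩
  · obtain ⟨u, hu⟩ := hex.exists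
    have hu' := hu.1
    rw [hrange] at hu'
    obtain ⟨v, rfl⟩ := hu'
    exact ⟨v, (hiff v).mp hu, fun v' hv' => hinj (hex.unique ((hiff v').mpr hv') hu)⟩
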